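/- **Definitions.** A *differential field* is a field of characteristic zero with an additive map $D$ satisfying the Leibniz rule. An extension $K\subset L=K(y)$ of differential fields is *exponential* if $D(y)=gy$ for some $g\in K$, and *logarithmic* if $D(y)\in K$ but $y\notin K$. An *elementary tower* of length $m$ over $K_0$ is a chain $K_0\subset K_1\subset\dots\subset K_m$ in which every $K_{i+1}\supset K_i$ is an exponential or a logarithmic extension. A function holomorphic near a point of $\mathbb{C}$ is (a branch of) an *elementary function of depth at most $N$* if its germ lies in the last field $K_m$ of an elementary tower of length $m\le N$ over $K_0=\mathbb{C}(x)$, the tower consisting of fields of germs of meromorphic functions with $D=d/dx$. For a meromorphic function $f$ on a connected open set $X\subseteq\mathbb{C}$, the *inverse* $f^{-1}$ is the multivalued analytic function consisting of all germs of holomorphic functions obtained by analytic continuation, along paths in $\mathbb{C}$, from local branches of the inverse, i.e. from germs $\psi$ with values in $X$ and $f(\psi(z))=z$. We say that $f^{-1}$ *is a composition of elementary functions of depth at most $N$* if some local branch of it exists and equals, near some point, a finite composition $\varphi_1\circ\dots\circ\varphi_k$ ($k\ge1$) of branches of elementary functions, each of depth at most $N$. (All local branches are analytic continuations of one another, so it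 does not matter which one is taken.) A *forbidden set* of $f^{-1}$ is an at most countable set $A\subset\mathbb{C}$ such that every germ of $f^{-1}$ can be analytically continued along every path that does not meet $A$ except possibly at its initial moment. The *monodromy group* of $f$ with forbidden set $A$ and base point $a\in\mathbb{C}\setminus A$ is the group of those permutations of the set of germs of $f^{-1}$ at $a$ that are induced by analytic continuation along loops in $\mathbb{C}\setminus A$ based at $a$ (the image of $\pi_1(\mathbb{C}\setminus A,a)$). **Proposition.** Let $N$ be a positive integer and let $f$ be a meromorphic function on a connected open set $X\subseteq\mathbb{C}$ whose inverse is a composition of elementary functions of depth at most $N$. Then the monodromy group of $f$ is solvable: $f^{-1}$ has a forbidden set, and for every forbidden set $A$ of $f^{-1}$ and every base point $a\in\mathbb{C}\setminus A$ the monodromy group of $f$ with forbidden set $A$ and base point $a$ is solvable. -/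

import Mathlib

open Filter Topology
open scoped Differential unitInterval

namespace TopGalois

/-! ### The differential field of germs of meromorphic functions at a point -/

/-- The ring of germs at `a` of meromorphic functions. Two meromorphic functions have the same germ
when they agree on a punctured neighbourhood of `a`. -/
def MeroGerm (a : ℂ) : Subring (Germ (𝓝[≠] a) ℂ) where
  carrier := {g | ∃ f : ℂ → ℂ, MeromorphicAt f a ∧ g = (f : Germ (𝓝[≠] a) ℂ)}
  mul_mem' := by
    rintro _ _ ⟨f, hf, rfl⟩ ⟨g, hg, rfl⟩
    exact ⟨f * g, hf.mul hg, rfl⟩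
  one_mem' := ⟨fun _ => 1, MeromorphicAt.const 1 a, rfl⟩
  add_mem' := by
    rintro _ _ ⟨f, hf, rfl⟩ ⟨g, hg, rfl⟩
    exact ⟨f + g, hf.add hg, rfl⟩
  zero_mem' := ⟨fun _ => 0, MeromorphicAt.const 0 a, rfl⟩
  neg_mem' := by
    rintro _ ⟨f, hf, rfl⟩
    exact ⟨-f, hf.neg, rfl⟩

namespace MeroGerm

/-- The germ at `a` of a function that is meromorphic at `a`. -/
noncomputable def of {a : ℂ} (f : ℂ → ℂ) (hf : MeromorphicAt f a) : MeroGerm a :=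
  ⟨(f : Germ (𝓝[≠] a) ℂ), f, hf, rfl⟩

theorem exists_of {a : ℂ} (g : MeroGerm a) :
    ∃ (f : ℂ → ℂ) (hf : MeromorphicAt f a), g = of f hf := by
  obtain ⟨_, f, hf, rfl⟩ := g
  exact ⟨f, hf, rfl⟩

theorem of_eq_of {a : ℂ} {f g : ℂ → ℂ} {hf : MeromorphicAt f a} {hg : MeromorphicAt g a} :
    of f hf = of g hg ↔ f =ᶠ[𝓝[≠] a] g := by
  exact Subtype.ext_iff.trans Germ.coe_eq

theorem of_add {a : ℂ} {f g : ℂ → ℂ} (hf : MeromorphicAt f a) (hg : MeromorphicAt g a) :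
    of f hf + of g hg = of (f + g) (hf.add hg) := rfl

theorem of_mul {a : ℂ} {f g : ℂ → ℂ} (hf : MeromorphicAt f a) (hg : MeromorphicAt g a) :
    of f hf * of g hg = of (f * g) (hf.mul hg) := rfl

theorem zero_eq_of (a : ℂ) : (0 : MeroGerm a) = of (fun _ => 0) (MeromorphicAt.const 0 a) := rfl

theorem one_eq_of (a : ℂ) : (1 : MeroGerm a) = of (fun _ => 1) (MeromorphicAt.const 1 a) := rfl

/-- The pointwise inverse `z ↦ (f z)⁻¹` on germs. -/
noncomputable instance (a : ℂ) : Inv (MeroGerm a) where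
  inv g := ⟨(g : Germ (𝓝[≠] a) ℂ)⁻¹, by
    obtain ⟨_, f, hf, rfl⟩ := g
    exact ⟨f⁻¹, hf.inv, rfl⟩⟩

theorem of_inv {a : ℂ} {f : ℂ → ℂ} (hf : MeromorphicAt f a) :
    (of f hf)⁻¹ = of f⁻¹ hf.inv := rfl

instance (a : ℂ) : Nontrivial (MeroGerm a) where
  exists_pair_ne := by
    refine ⟨0, 1, fun h => ?_⟩
    rw [zero_eq_of, one_eq_of, of_eq_of] at h
    obtain ⟨z, hz⟩ := h.exists
    exact zero_ne_one hz

theorem mul_inv_cancel' {a : ℂ} (g : MeroGerm a) (hg : g ≠ 0) : g * g⁻¹ = 1 := by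
  obtain ⟨f, hf, rfl⟩ := exists_of g
  rw [of_inv, of_mul, one_eq_of, of_eq_of]
  rcases hf.eventually_eq_zero_or_eventually_ne_zero with h | h
  · exact absurd (by rw [zero_eq_of, of_eq_of]; exact h) hg
  · filter_upwards [h] with z hz
    simp [hz]

theorem inv_zero' (a : ℂ) : (0 : MeroGerm a)⁻¹ = 0 := by
  rw [zero_eq_of, of_inv, of_eq_of]
  filter_upwards with z
  simp

noncomputable instance instField (a : ℂ) : Field (MeroGerm a) where
  __ := (inferInstance : CommRing (MeroGerm a))
  __ := (inferInstance : Nontrivial (MeroGerm a))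
  inv := Inv.inv
  mul_inv_cancel := mul_inv_cancel'
  inv_zero := inv_zero' a
  nnqsmul := _
  nnqsmul_def := fun _ _ => rfl
  qsmul := _
  qsmul_def := fun _ _ => rfl

/-- Termwise differentiation `f ↦ f'` of germs. -/
noncomputable def derivFun {a : ℂ} (g : MeroGerm a) : MeroGerm a :=
  ⟨Germ.map' deriv (fun _ _ h => h.nhdsNE_deriv) (g : Germ (𝓝[≠] a) ℂ), by
    obtain ⟨_, f, hf, rfl⟩ := g
    exact ⟨deriv f, hf.deriv, rfl⟩⟩

theorem derivFun_of {a : ℂ} {f : ℂ → ℂ} (hf : MeromorphicAt f a) :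
    derivFun (of f hf) = of (deriv f) hf.deriv := rfl

theorem derivFun_add {a : ℂ} (u v : MeroGerm a) :
    derivFun (u + v) = derivFun u + derivFun v := by
  obtain ⟨f, hf, rfl⟩ := exists_of u
  obtain ⟨g, hg, rfl⟩ := exists_of v
  rw [of_add, derivFun_of, derivFun_of, derivFun_of, of_add, of_eq_of]
  filter_upwards [hf.eventually_analyticAt, hg.eventually_analyticAt] with z h1 h2
  exact deriv_add h1.differentiableAt h2.differentiableAt

theorem derivFun_mul {a : ℂ} (u v : MeroGerm a) :
    derivFun (u * v) = u * derivFun v + v * derivFun u := by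
  obtain ⟨f, hf, rfl⟩ := exists_of u
  obtain ⟨g, hg, rfl⟩ := exists_of v
  rw [of_mul, derivFun_of, derivFun_of, derivFun_of, of_mul, of_mul, of_add, of_eq_of]
  filter_upwards [hf.eventually_analyticAt, hg.eventually_analyticAt] with z h1 h2
  rw [deriv_mul h1.differentiableAt h2.differentiableAt]
  simp only [Pi.add_apply, Pi.mul_apply]
  ring

/-- The field of germs of meromorphic functions at `a` is a differential field under `d/dz`. -/
noncomputable instance (a : ℂ) : Differential (MeroGerm a) where
  deriv := Derivation.mk' (AddMonoidHom.mk' derivFun derivFun_add).toIntLinearMap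
    fun u v => derivFun_mul u v

theorem deriv_of {a : ℂ} {f : ℂ → ℂ} (hf : MeromorphicAt f a) :
    (of f hf)′ = of (deriv f) hf.deriv := rfl

/-- The field `ℂ(x)` of rational functions, as a subfield of the field of meromorphic germs: it is
generated by the constants and the identity function. -/
noncomputable def ratFunc (a : ℂ) : Subfield (MeroGerm a) :=
  Subfield.closure
    (Set.range (fun c : ℂ => of (fun _ => c) (MeromorphicAt.const c a)) ∪
      {of (fun z => z) (MeromorphicAt.id a)})

end MeroGerm

/-! ### Elementary functions and their depth -/

section Towers

/-- `L = K(y)` for some `y` with `y' = g y`, `g ∈ K`. -/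
def IsExponentialExtension {M : Type*} [Field M] [Differential M] (K L : Subfield M) : Prop :=
  ∃ y : M, (∃ g ∈ K, y′ = g * y) ∧ L = Subfield.closure ((K : Set M) ∪ {y})

/-- `L = K(y)` for some `y ∉ K` with `y' ∈ K`. -/
def IsLogarithmicExtension {M : Type*} [Field M] [Differential M] (K L : Subfield M) : Prop :=
  ∃ y : M, y′ ∈ K ∧ y ∉ K ∧ L = Subfield.closure ((K : Set M) ∪ {y})

/-- `K 0 ⊂ K 1 ⊂ ⋯ ⊂ K m` is an elementary tower over `K 0 = K₀`. (If `K₀` is closed under the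
derivation, then so is every field of the tower.) -/
def IsElementaryTower {M : Type*} [Field M] [Differential M] (K₀ : Subfield M) (m : ℕ)
    (K : ℕ → Subfield M) : Prop :=
  K 0 = K₀ ∧ ∀ i < m, IsExponentialExtension (K i) (K (i + 1)) ∨
    IsLogarithmicExtension (K i) (K (i + 1))

end Towers

/-- `f` is, near the point `a`, a (holomorphic branch of an) elementary function of depth at most
`N`: its germ lies in the last field of an elementary tower over `ℂ(x)` of length at most `N`. -/
def IsElementaryAt (N : ℕ) (a : ℂ) (f : ℂ → ℂ) : Prop :=
  ∃ hf : AnalyticAt ℂ f a, ∃ m ≤ N, ∃ K : ℕ → Subfield (MeroGerm a),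
    IsElementaryTower (MeroGerm.ratFunc a) m K ∧ MeroGerm.of f hf.meromorphicAt ∈ K m

/-- `f` is, near the point `a`, a finite composition `φ₁ ∘ ⋯ ∘ φₖ`, `k ≥ 1`, of elementary functions
of depth at most `N`. -/
inductive IsElementaryCompositionAt (N : ℕ) : ℂ → (ℂ → ℂ) → Prop
  | single {a : ℂ} {φ : ℂ → ℂ} (hφ : IsElementaryAt N a φ) : IsElementaryCompositionAt N a φ
  | comp {a : ℂ} {φ g : ℂ → ℂ} (hφ : IsElementaryAt N (g a) φ)
      (hg : IsElementaryCompositionAt N a g) : IsElementaryCompositionAt N a (φ ∘ g)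

/-! ### Analytic continuation and monodromy -/

/-- The regular germs at `a`, that is, the germs of functions holomorphic near `a`. -/
def HolGerm (a : ℂ) : Type :=
  {g : Germ (𝓝 a) ℂ // ∃ f : ℂ → ℂ, AnalyticAt ℂ f a ∧ g = (f : Germ (𝓝 a) ℂ)}

/-- Analytic continuation along the path `γ` carries the germ `g` to the germ `h`: there are
functions `φ t`, holomorphic near `γ t`, such that `φ s` and `φ t` have the same germ at `γ s` for
`s` close to `t`, and `φ 0`, `φ 1` represent `g`, `h`. -/
def ContinuesTo {a b : ℂ} (γ : Path a b) (g : HolGerm a) (h : HolGerm b) : Prop :=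
  ∃ φ : I → ℂ → ℂ,
    (∀ t, AnalyticAt ℂ (φ t) (γ t) ∧ ∀ᶠ s in 𝓝 t, φ s =ᶠ[𝓝 (γ s)] φ t) ∧
    g.1 = (φ 0 : Germ (𝓝 a) ℂ) ∧ h.1 = (φ 1 : Germ (𝓝 b) ℂ)

/-- A multivalued analytic function, given by the set of its regular germs at every point. -/
abbrev MultiFun : Type := (b : ℂ) → Set (HolGerm b)

/-- `A` is a forbidden set of the multivalued function `F`: it is at most countable, and every
regular germ of `F` admits a continuation along every path that does not meet `A`, except possibly
at the initial moment. -/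
def IsForbiddenSet (A : Set ℂ) (F : MultiFun) : Prop :=
  A.Countable ∧ ∀ (b : ℂ), ∀ g ∈ F b, ∀ (c : ℂ) (γ : Path b c),
    (∀ t : I, t ≠ 0 → γ t ∉ A) → ∃ h : HolGerm c, ContinuesTo γ g h

theorem ContinuesTo.refl {a : ℂ} (g : HolGerm a) : ContinuesTo (Path.refl a) g g := by
  obtain ⟨_, f, hf, rfl⟩ := g
  exact ⟨fun _ => f, fun t => ⟨hf, Eventually.of_forall fun s => EventuallyEq.rfl⟩, rfl, rfl⟩

theorem ContinuesTo.symm {a b : ℂ} {γ : Path a b} {g : HolGerm a} {h : HolGerm b}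
    (H : ContinuesTo γ g h) : ContinuesTo γ.symm h g := by
  obtain ⟨φ, hφ, h0, h1⟩ := H
  refine ⟨fun t => φ (unitInterval.symm t), fun t => ⟨(hφ _).1, ?_⟩, by simpa using h1,
    by simpa using h0⟩
  exact (unitInterval.continuous_symm.tendsto t).eventually (hφ (unitInterval.symm t)).2

theorem ContinuesTo.trans {a b c : ℂ} {γ : Path a b} {δ : Path b c} {g : HolGerm a}
    {h : HolGerm b} {k : HolGerm c} (H₁ : ContinuesTo γ g h) (H₂ : ContinuesTo δ h k) :
    ContinuesTo (γ.trans δ) g k := by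
  obtain ⟨φ, hφ, hφ0, hφ1⟩ := H₁
  obtain ⟨χ, hχ, hχ0, hχ1⟩ := H₂
  set α : I → I := fun s => Set.projIcc 0 1 zero_le_one (2 * (s : ℝ)) with hα
  set β : I → I := fun s => Set.projIcc 0 1 zero_le_one (2 * (s : ℝ) - 1) with hβ
  have hαc : Continuous α := continuous_projIcc.comp (by fun_prop)
  have hβc : Continuous β := continuous_projIcc.comp (by fun_prop)
  have hα1 : ∀ s : I, (1 : ℝ) / 2 ≤ s → α s = 1 := fun s hs =>
    Set.projIcc_of_right_le _ (by linarith)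
  have hβ0 : ∀ s : I, (s : ℝ) ≤ 1 / 2 → β s = 0 := fun s hs =>
    Set.projIcc_of_le_left _ (by linarith)
  have hle : ∀ s : I, (s : ℝ) ≤ 1 / 2 → (γ.trans δ) s = γ (α s) := by
    intro s hs
    rw [Path.trans_apply, dif_pos hs]
    congr 1
    exact (Set.projIcc_of_mem zero_le_one _).symm
  have hge : ∀ s : I, (1 : ℝ) / 2 ≤ s → (γ.trans δ) s = δ (β s) := by
    intro s hs
    rcases hs.eq_or_lt with hs' | hs'
    · rw [hle s hs'.ge, hα1 s hs, hβ0 s hs'.ge]; simp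
    · rw [Path.trans_apply, dif_neg (not_le.2 hs')]
      congr 1
      exact (Set.projIcc_of_mem zero_le_one _).symm
  have hglue : φ 1 =ᶠ[𝓝 b] χ 0 := Germ.coe_eq.1 (hφ1.symm.trans hχ0)
  refine ⟨fun s => if (s : ℝ) ≤ 1 / 2 then φ (α s) else χ (β s), fun t => ⟨?_, ?_⟩, ?_, ?_⟩
  · by_cases ht : (t : ℝ) ≤ 1 / 2
    · simp only [if_pos ht, hle t ht]; exact (hφ _).1
    · simp only [if_neg ht, hge t (not_le.1 ht).le]; exact (hχ _).1
  · have c1 : ∀ᶠ s in 𝓝 t, φ (α s) =ᶠ[𝓝 (γ (α s))] φ (α t) :=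
      (hαc.tendsto t).eventually (hφ (α t)).2
    have c2 : ∀ᶠ s in 𝓝 t, χ (β s) =ᶠ[𝓝 (δ (β s))] χ (β t) :=
      (hβc.tendsto t).eventually (hχ (β t)).2
    have hval : Continuous (fun s : I => (s : ℝ)) := continuous_subtype_val
    rcases lt_trichotomy (t : ℝ) (1 / 2) with ht | ht | ht
    · filter_upwards [c1, hval.continuousAt.eventually_lt continuousAt_const ht] with s h1 hs
      rw [if_pos hs.le, if_pos ht.le, hle s hs.le]
      exact h1
    · have c3 : ∀ᶠ s in 𝓝 t, φ 1 =ᶠ[𝓝 (δ (β s))] χ 0 := by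
        have hb : δ (β t) = b := by rw [hβ0 t ht.le]; exact δ.source
        have := (δ.continuous.comp hβc).tendsto t
        rw [Function.comp_apply, hb] at this
        exact this.eventually hglue.eventually_nhds
      filter_upwards [c1, c2, c3] with s h1 h2 h3
      rw [if_pos ht.le]
      by_cases hs : (s : ℝ) ≤ 1 / 2
      · rw [if_pos hs, hle s hs]
        exact h1
      · rw [if_neg hs, hge s (not_le.1 hs).le, hα1 t ht.ge]
        rw [hβ0 t ht.le] at h2
        exact h2.trans h3.symm
    · filter_upwards [c2, continuousAt_const.eventually_lt hval.continuousAt ht] with s h2 hs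
      rw [if_neg (not_le.2 hs), if_neg (not_le.2 ht), hge s hs.le]
      exact h2
  · have h0 : α 0 = 0 := Set.projIcc_of_le_left _ (by simp)
    simpa [h0] using hφ0
  · have h1 : β 1 = 1 := Set.projIcc_of_right_le _ (by norm_num)
    have : ¬ (((1 : I) : ℝ) ≤ 1 / 2) := by norm_num
    simp only [if_neg this, h1]
    exact hχ1

/-- The monodromy group of the multivalued function `F` with forbidden set `A` and base point `a`:
the group of all permutations of the set of germs of `F` at `a` that are induced by analytic
continuation along loops in `ℂ ∖ A` based at `a`. -/
def monodromyGroup (F : MultiFun) (A : Set ℂ) (a : ℂ) (ha : a ∉ A) :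
    Subgroup (Equiv.Perm (F a)) where
  carrier := {p | ∃ γ : Path a a, (∀ t, γ t ∉ A) ∧ ∀ g : F a, ContinuesTo γ g.1 (p g).1}
  one_mem' := ⟨Path.refl a, fun _ => ha, fun g => ContinuesTo.refl g.1⟩
  mul_mem' := by
    rintro p q ⟨γ, hγ, hp⟩ ⟨δ, hδ, hq⟩
    refine ⟨δ.trans γ, fun t => ?_, fun g => (hq g).trans (hp (q g))⟩
    have : (δ.trans γ) t ∈ Set.range (δ.trans γ) := ⟨t, rfl⟩
    rw [Path.trans_range] at this
    rcases this with ⟨s, hs⟩ | ⟨s, hs⟩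
    · exact hs ▸ hδ s
    · exact hs ▸ hγ s
  inv_mem' := by
    rintro p ⟨γ, hγ, hp⟩
    refine ⟨γ.symm, fun t => hγ _, fun g => ?_⟩
    have := (hp (p⁻¹ g)).symm
    simpa using this

/-! ### The inverse of a meromorphic function -/

/-- The function `ψ`, holomorphic near `a`, is a local branch of the inverse of `f : X → ℂ`. -/
def IsInverseBranchAt (f : ℂ → ℂ) (X : Set ℂ) (a : ℂ) (ψ : ℂ → ℂ) : Prop :=
  AnalyticAt ℂ ψ a ∧ ψ a ∈ X ∧ ∀ᶠ z in 𝓝 a, f (ψ z) = z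

/-- The multivalued inverse `f⁻¹` of `f : X → ℂ`: its germs are the germs of the local branches of
the inverse, and all germs obtained from them by analytic continuation along paths. -/
def inverseFun (f : ℂ → ℂ) (X : Set ℂ) : MultiFun := fun b =>
  {h | ∃ (a : ℂ) (ψ : ℂ → ℂ) (hψ : IsInverseBranchAt f X a ψ) (γ : Path a b),
    ContinuesTo γ ⟨(ψ : Germ (𝓝 a) ℂ), ψ, hψ.1, rfl⟩ h}

/-- The inverse of `f : X → ℂ` is a composition of elementary functions of depth at most `N`.
As `X` is connected, all branches of the inverse are analytic continuations of each other, so that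
this is a condition on one branch. -/
def InverseIsElementaryComposition (f : ℂ → ℂ) (X : Set ℂ) (N : ℕ) : Prop :=
  ∃ (a : ℂ) (ψ : ℂ → ℂ), IsInverseBranchAt f X a ψ ∧ IsElementaryCompositionAt N a ψ

end TopGalois

namespace TopGalois

/-! ### Analytic continuation of functions along paths -/

/-! This is topological Galois theory: solvability is read off from analytic continuation alone,
through a class of functions closed under every operation that builds elementary functions. The
class is `SolvableOff A n z f`: with `A` countable, `f` continues along all paths off `A`, and every
germ so obtained is fixed by the loops off `A` lying in the `n`-th derived subgroup.

Sums and products stay in the class for the same `n`; so do inverses, once the zeros of all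
continuations are added to `A`. A primitive costs one more commutator (`SolvableOff.primitive`):
loops that fix the derivative change the primitive by translations, and translations commute. A
solution of `g' = f g` is `c * exp` of a primitive. Hence a tower of length `m` consists of
functions of derived length at most `m` (`MeroGerm.tower_le_tame`). For a composition the derived
lengths add (`SolvableOff.comp`), after removing the points where the inner function takes values in
the forbidden set of the outer one. That these removed sets are countable is the Poincaré–Volterra
argument in `countable_continuation_mem`.

All germs of the inverse are continuations of a single branch
(`IsInverseBranchAt.exists_continues`), so its set `A` is forbidden for the inverse. For any other
forbidden set `A'`, an iterated commutator loop off `A'` is replaced by an iterated commutator loop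
off `A`, at a nearby base point, performing the same finitely many continuations
(`DLoop.eventually_exists`); it therefore acts trivially too, and the `n`-th derived subgroup
vanishes.

Loops are kept as concrete paths (`CommClosure`, `DLoop`), never as homotopy classes, so the
monodromy theorem is not needed. -/

theorem eventuallyEq_of_mem_ball {f g : ℂ → ℂ} {c : ℂ} {r : ℝ}
    (hf : AnalyticOnNhd ℂ f (Metric.ball c r)) (hg : AnalyticOnNhd ℂ g (Metric.ball c r))
    {x y : ℂ} (hx : x ∈ Metric.ball c r) (hy : y ∈ Metric.ball c r) (h : f =ᶠ[𝓝 x] g) :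
    f =ᶠ[𝓝 y] g :=
  (hf.eqOn_of_preconnected_of_eventuallyEq hg (convex_ball c r).isPreconnected hx
    h).eventuallyEq_of_mem (Metric.isOpen_ball.mem_nhds hy)

theorem exists_ball_analyticOnNhd {f : ℂ → ℂ} {z : ℂ} (hf : AnalyticAt ℂ f z) :
    ∃ r > 0, AnalyticOnNhd ℂ f (Metric.ball z r) :=
  Metric.eventually_nhds_iff_ball.1 hf.eventually_analyticAt

/-- By the identity theorem, equality of germs is locally constant in the base point; this drives
the connectedness arguments along paths. -/
theorem eventually_eventuallyEq_iff {f g : ℂ → ℂ} {z : ℂ} (hf : AnalyticAt ℂ f z)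
    (hg : AnalyticAt ℂ g z) : ∀ᶠ w in 𝓝 z, (f =ᶠ[𝓝 w] g ↔ f =ᶠ[𝓝 z] g) := by
  obtain ⟨r, hr, h⟩ := Metric.eventually_nhds_iff_ball.1
    (hf.eventually_analyticAt.and hg.eventually_analyticAt)
  have hf' : AnalyticOnNhd ℂ f (Metric.ball z r) := fun w hw => (h w hw).1
  have hg' : AnalyticOnNhd ℂ g (Metric.ball z r) := fun w hw => (h w hw).2
  filter_upwards [Metric.ball_mem_nhds z hr] with w hw
  exact ⟨eventuallyEq_of_mem_ball hf' hg' hw (Metric.mem_ball_self hr),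
    eventuallyEq_of_mem_ball hf' hg' (Metric.mem_ball_self hr) hw⟩

/-- A property of the points of the unit interval that is locally constant holds everywhere as soon
as it holds somewhere. -/
theorem forall_of_eventually_iff {W : I → Prop} (hW : ∀ t, ∀ᶠ s in 𝓝 t, (W s ↔ W t)) {t₀ : I}
    (h₀ : W t₀) (t : I) : W t := by
  have : IsLocallyConstant W :=
    (IsLocallyConstant.iff_eventually_eq W).2 fun t => (hW t).mono fun s hs => propext hs
  rw [this.apply_eq_of_preconnectedSpace t t₀]
  exact h₀

/-- `φ` is an analytic continuation along the curve `γ`: a compatible family of functions `φ t`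
holomorphic near `γ t`. -/
def IsContinuation (γ : I → ℂ) (φ : I → ℂ → ℂ) : Prop :=
  ∀ t, AnalyticAt ℂ (φ t) (γ t) ∧ ∀ᶠ s in 𝓝 t, φ s =ᶠ[𝓝 (γ s)] φ t

namespace IsContinuation

variable {γ : I → ℂ} {φ χ : I → ℂ → ℂ}

theorem unique (hγ : Continuous γ) (hφ : IsContinuation γ φ) (hχ : IsContinuation γ χ) {t₀ : I}
    (h : φ t₀ =ᶠ[𝓝 (γ t₀)] χ t₀) (t : I) : φ t =ᶠ[𝓝 (γ t)] χ t := by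
  refine forall_of_eventually_iff (W := fun t => φ t =ᶠ[𝓝 (γ t)] χ t) (fun t => ?_) h t
  filter_upwards [(hφ t).2, (hχ t).2,
    (hγ.tendsto t).eventually (eventually_eventuallyEq_iff (hφ t).1 (hχ t).1)] with s h1 h2 h3
  rw [← h3]
  exact ⟨fun h => h1.symm.trans (h.trans h2), fun h => h1.trans (h.trans h2.symm)⟩

theorem continuous_value (hγ : Continuous γ) (hφ : IsContinuation γ φ) :
    Continuous fun t => φ t (γ t) := by
  refine continuous_iff_continuousAt.2 fun t => ?_
  have h : (fun s => φ t (γ s)) =ᶠ[𝓝 t] fun s => φ s (γ s) :=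
    (hφ t).2.mono fun s hs => hs.self_of_nhds.symm
  exact ContinuousAt.congr ((hφ t).1.continuousAt.comp hγ.continuousAt) h

theorem comp_continuous (hφ : IsContinuation γ φ) {τ : I → I} (hτ : Continuous τ) :
    IsContinuation (γ ∘ τ) (φ ∘ τ) := fun t =>
  ⟨(hφ (τ t)).1, (hτ.tendsto t).eventually (hφ (τ t)).2⟩

theorem of_analyticAt {F : ℂ → ℂ} (h : ∀ t, AnalyticAt ℂ F (γ t)) :
    IsContinuation γ fun _ => F := fun t =>
  ⟨h t, Eventually.of_forall fun _ => EventuallyEq.rfl⟩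

theorem add (hφ : IsContinuation γ φ) (hχ : IsContinuation γ χ) :
    IsContinuation γ fun t => φ t + χ t := fun t =>
  ⟨(hφ t).1.add (hχ t).1, by
    filter_upwards [(hφ t).2, (hχ t).2] with s h1 h2 using h1.add h2⟩

theorem mul (hφ : IsContinuation γ φ) (hχ : IsContinuation γ χ) :
    IsContinuation γ fun t => φ t * χ t := fun t =>
  ⟨(hφ t).1.mul (hχ t).1, by
    filter_upwards [(hφ t).2, (hχ t).2] with s h1 h2 using h1.mul h2⟩

theorem inv (hφ : IsContinuation γ φ) (h0 : ∀ t, φ t (γ t) ≠ 0) :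
    IsContinuation γ fun t => (φ t)⁻¹ := fun t =>
  ⟨(hφ t).1.inv (h0 t), by filter_upwards [(hφ t).2] with s h1 using h1.inv⟩

theorem deriv (hφ : IsContinuation γ φ) : IsContinuation γ fun t => deriv (φ t) := fun t =>
  ⟨(hφ t).1.deriv, by filter_upwards [(hφ t).2] with s h1 using h1.deriv⟩

theorem comp (hφ : IsContinuation γ φ)
    (hχ : IsContinuation (fun t => φ t (γ t)) χ) : IsContinuation γ fun t => χ t ∘ φ t := fun t =>
  ⟨(hχ t).1.comp (hφ t).1, by
    filter_upwards [(hφ t).2.eventually_nhds, (hχ t).2] with s h1 h2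
    have h3 := h1.self_of_nhds
    have h4 : Tendsto (φ s) (𝓝 (γ s)) (𝓝 (φ s (γ s))) := (hφ s).1.continuousAt
    filter_upwards [h3, h4.eventually h2] with z hz1 hz2
    rw [Function.comp_apply, Function.comp_apply, hz2, hz1]⟩

end IsContinuation

/-- Analytic continuation along `γ` carries the germ of `f` to the germ of `h`. -/
def Continues {a b : ℂ} (γ : Path a b) (f h : ℂ → ℂ) : Prop :=
  ∃ φ, IsContinuation γ φ ∧ f =ᶠ[𝓝 a] φ 0 ∧ h =ᶠ[𝓝 b] φ 1

/-- Lets the proof work with representing functions instead of `HolGerm`. -/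
theorem continuesTo_iff {a b : ℂ} {γ : Path a b} {g : HolGerm a} {k : HolGerm b} {f h : ℂ → ℂ}
    (hf : g.1 = (f : Germ (𝓝 a) ℂ)) (hh : k.1 = (h : Germ (𝓝 b) ℂ)) :
    ContinuesTo γ g k ↔ Continues γ f h := by
  simp only [ContinuesTo, Continues, IsContinuation, hf, hh, Germ.coe_eq]

namespace Continues

variable {a b c : ℂ} {γ : Path a b} {f h k : ℂ → ℂ}

theorem analyticAt_left (H : Continues γ f h) : AnalyticAt ℂ f a := by
  obtain ⟨φ, hφ, h0, h1⟩ := H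
  have := (hφ 0).1
  rw [γ.source] at this
  exact this.congr h0.symm

theorem analyticAt_right (H : Continues γ f h) : AnalyticAt ℂ h b := by
  obtain ⟨φ, hφ, h0, h1⟩ := H
  have := (hφ 1).1
  rw [γ.target] at this
  exact this.congr h1.symm

theorem congr (H : Continues γ f h) {f' h' : ℂ → ℂ} (hf : f' =ᶠ[𝓝 a] f) (hh : h' =ᶠ[𝓝 b] h) :
    Continues γ f' h' := by
  obtain ⟨φ, hφ, h0, h1⟩ := H
  exact ⟨φ, hφ, hf.trans h0, hh.trans h1⟩

theorem unique (H : Continues γ f h) {f' h' : ℂ → ℂ} (H' : Continues γ f' h') (hf : f =ᶠ[𝓝 a] f') :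
    h =ᶠ[𝓝 b] h' := by
  obtain ⟨φ, hφ, h0, h1⟩ := H
  obtain ⟨χ, hχ, h0', h1'⟩ := H'
  have := hφ.unique γ.continuous hχ (t₀ := 0)
    (by rw [γ.source]; exact h0.symm.trans (hf.trans h0')) 1
  rw [γ.target] at this
  exact h1.trans (this.trans h1'.symm)

theorem of_analyticAt (hf : ∀ t, AnalyticAt ℂ f (γ t)) : Continues γ f f :=
  ⟨fun _ => f, IsContinuation.of_analyticAt hf, EventuallyEq.rfl, EventuallyEq.rfl⟩

theorem refl_iff : Continues (Path.refl a) f h ↔ AnalyticAt ℂ f a ∧ f =ᶠ[𝓝 a] h := by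
  constructor
  · intro H
    refine ⟨H.analyticAt_left, ?_⟩
    exact unique (of_analyticAt fun _ => H.analyticAt_left) H EventuallyEq.rfl
  · rintro ⟨h1, h2⟩
    exact (of_analyticAt (γ := Path.refl a) fun _ => h1).congr EventuallyEq.rfl h2.symm

theorem symm (H : Continues γ f h) : Continues γ.symm h f := by
  obtain ⟨φ, hφ, h0, h1⟩ := H
  exact ⟨φ ∘ unitInterval.symm, hφ.comp_continuous unitInterval.continuous_symm,
    by simpa using h1, by simpa using h0⟩

theorem symm_iff : Continues γ.symm h f ↔ Continues γ f h :=
  ⟨fun H => by simpa using H.symm, symm⟩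

theorem trans (H : Continues γ f h) {δ : Path b c} (H' : Continues δ h k) :
    Continues (γ.trans δ) f k := by
  let g₀ : HolGerm a := ⟨(f : Germ (𝓝 a) ℂ), f, H.analyticAt_left, rfl⟩
  let g₁ : HolGerm b := ⟨(h : Germ (𝓝 b) ℂ), h, H.analyticAt_right, rfl⟩
  let g₂ : HolGerm c := ⟨(k : Germ (𝓝 c) ℂ), k, H'.analyticAt_right, rfl⟩
  exact (continuesTo_iff (g := g₀) (k := g₂) rfl rfl).1
    (((continuesTo_iff (g := g₀) (k := g₁) rfl rfl).2 H).trans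
      ((continuesTo_iff (g := g₁) (k := g₂) rfl rfl).2 H'))

theorem of_trans {δ : Path b c} (H : Continues (γ.trans δ) f k) :
    ∃ h, Continues γ f h ∧ Continues δ h k := by
  obtain ⟨φ, hφ, h0, h1⟩ := H
  set α : I → I := fun s => ⟨(s : ℝ) / 2, by constructor <;> linarith [s.2.1, s.2.2]⟩ with hα
  set β : I → I := fun s => ⟨((s : ℝ) + 1) / 2, by constructor <;> linarith [s.2.1, s.2.2]⟩ with hβ
  have hαc : Continuous α := by fun_prop
  have hβc : Continuous β := by fun_prop
  have e1 : (γ.trans δ) ∘ α = γ := by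
    ext s
    have hs : ((α s : I) : ℝ) ≤ 1 / 2 := by simp only [hα]; linarith [s.2.2]
    rw [Function.comp_apply, Path.trans_apply, dif_pos hs]
    congr 1
    ext
    simp only [hα]
    ring
  have e2 : (γ.trans δ) ∘ β = δ := by
    ext s
    -- At `s = 0` the point `β s = 1/2` still falls in the first half of the concatenation, so it is
    -- treated apart.
    by_cases hs : ((β s : I) : ℝ) ≤ 1 / 2
    · have hs0 : s = 0 := by
        ext
        simp only [hβ] at hs
        have := s.2.1
        simp only [Set.Icc.coe_zero]
        linarith
      subst hs0
      rw [Function.comp_apply, Path.trans_apply, dif_pos hs, δ.source]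
      convert γ.target using 2
      ext
      simp [hβ]
    · rw [Function.comp_apply, Path.trans_apply, dif_neg hs]
      congr 1
      ext
      simp only [hβ]
      ring
  have eα0 : α 0 = 0 := by ext; simp [hα]
  have eβ1 : β 1 = 1 := by ext; simp [hβ]
  have eαβ : α 1 = β 0 := by ext; simp [hα, hβ]
  refine ⟨φ (α 1), ⟨φ ∘ α, e1 ▸ hφ.comp_continuous hαc, ?_, EventuallyEq.rfl⟩,
    ⟨φ ∘ β, e2 ▸ hφ.comp_continuous hβc, ?_, ?_⟩⟩
  · simpa [eα0] using h0
  · rw [eαβ]; rfl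
  · simpa [eβ1] using h1

theorem add (H : Continues γ f h) {f' h' : ℂ → ℂ} (H' : Continues γ f' h') :
    Continues γ (f + f') (h + h') := by
  obtain ⟨φ, hφ, h0, h1⟩ := H
  obtain ⟨χ, hχ, h0', h1'⟩ := H'
  exact ⟨_, hφ.add hχ, h0.add h0', h1.add h1'⟩

theorem mul (H : Continues γ f h) {f' h' : ℂ → ℂ} (H' : Continues γ f' h') :
    Continues γ (f * f') (h * h') := by
  obtain ⟨φ, hφ, h0, h1⟩ := H
  obtain ⟨χ, hχ, h0', h1'⟩ := H'
  exact ⟨_, hφ.mul hχ, h0.mul h0', h1.mul h1'⟩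

theorem deriv (H : Continues γ f h) : Continues γ (deriv f) (deriv h) := by
  obtain ⟨φ, hφ, h0, h1⟩ := H
  exact ⟨_, hφ.deriv, h0.deriv, h1.deriv⟩

theorem of_differentiable {F : ℂ → ℂ} (hF : Differentiable ℂ F) : Continues γ F F :=
  of_analyticAt fun _ => hF.analyticAt _

theorem comp_left (H : Continues γ f h) {F : ℂ → ℂ} (hF : Differentiable ℂ F) :
    Continues γ (F ∘ f) (F ∘ h) := by
  obtain ⟨φ, hφ, h0, h1⟩ := H
  exact ⟨_, hφ.comp (IsContinuation.of_analyticAt fun _ => hF.analyticAt _),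
    h0.fun_comp F, h1.fun_comp F⟩

end Continues

/-! ### Gluing and primitives -/

namespace IsContinuation

variable {γ : I → ℂ} {φ χ : I → ℂ → ℂ}

/-- Freezing `γ` at `u` by `min` and `max` keeps `I` as the parameter interval of both pieces, so no
reparametrisation is needed. -/
theorem glue (hγ : Continuous γ) {u : I} (hφ : IsContinuation (fun s => γ (min s u)) φ)
    (hχ : IsContinuation (fun s => γ (max s u)) χ) (h : φ u =ᶠ[𝓝 (γ u)] χ u) :
    IsContinuation γ fun s => if s ≤ u then φ s else χ s := by
  intro t
  rcases lt_trichotomy t u with ht | rfl | ht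
  · have := hφ t
    dsimp only at this
    rw [min_eq_left ht.le] at this
    simp only [if_pos ht.le]
    refine ⟨this.1, ?_⟩
    filter_upwards [this.2, eventually_lt_nhds ht] with s h1 h2
    rw [min_eq_left h2.le] at h1
    rw [if_pos h2.le]
    exact h1
  · have h1 := hφ t
    have h2 := hχ t
    dsimp only at h1 h2
    rw [min_self] at h1
    rw [max_self] at h2
    simp only [le_refl, if_true]
    refine ⟨h1.1, ?_⟩
    filter_upwards [h1.2, h2.2, (hγ.tendsto t).eventually h.eventually_nhds] with s e1 e2 e3
    split_ifs with hs
    · rwa [min_eq_left hs] at e1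
    · rw [max_eq_left (not_le.1 hs).le] at e2
      exact e2.trans (EventuallyEq.symm e3)
  · have := hχ t
    dsimp only at this
    rw [max_eq_left ht.le] at this
    simp only [if_neg (not_le.2 ht)]
    refine ⟨this.1, ?_⟩
    filter_upwards [this.2, eventually_gt_nhds ht] with s h1 h2
    rw [max_eq_left h2.le] at h1
    rw [if_neg (not_le.2 h2)]
    exact h1

end IsContinuation

theorem exists_eventuallyEq_add_const {f g : ℂ → ℂ} {z : ℂ} (hf : AnalyticAt ℂ f z)
    (hg : AnalyticAt ℂ g z) (h : deriv f =ᶠ[𝓝 z] deriv g) :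
    ∃ c : ℂ, f =ᶠ[𝓝 z] fun w => g w + c := by
  obtain ⟨r, hr, H⟩ := Metric.eventually_nhds_iff_ball.1
    ((hf.eventually_analyticAt.and hg.eventually_analyticAt).and h)
  obtain ⟨c, hc⟩ := Metric.isOpen_ball.exists_eq_add_of_deriv_eq
    (convex_ball z r).isPreconnected
    (fun w hw => (H w hw).1.1.differentiableAt.differentiableWithinAt)
    (fun w hw => (H w hw).1.2.differentiableAt.differentiableWithinAt) (fun w hw => (H w hw).2)
  exact ⟨c, hc.eventuallyEq_of_mem (Metric.ball_mem_nhds z hr)⟩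

theorem exists_primitive_on_ball {f : ℂ → ℂ} {c : ℂ} {r : ℝ}
    (hf : AnalyticOnNhd ℂ f (Metric.ball c r)) :
    ∃ G : ℂ → ℂ, AnalyticOnNhd ℂ G (Metric.ball c r) ∧ ∀ z ∈ Metric.ball c r, deriv G z = f z := by
  obtain ⟨G, hG⟩ := hf.differentiableOn.isExactOn_ball
  refine ⟨G, DifferentiableOn.analyticOnNhd
    (fun z hz => (hG z hz).differentiableAt.differentiableWithinAt) Metric.isOpen_ball,
    fun z hz => (hG z hz).deriv⟩

theorem IsContinuation.exists_primitive {γ : I → ℂ} (hγ : Continuous γ) {φ : I → ℂ → ℂ}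
    (hφ : IsContinuation γ φ) {Y : ℂ → ℂ} (hY : AnalyticAt ℂ Y (γ 0))
    (h0 : _root_.deriv Y =ᶠ[𝓝 (γ 0)] φ 0) :
    ∃ Φ, IsContinuation γ Φ ∧ Φ 0 =ᶠ[𝓝 (γ 0)] Y := by
  -- `W t` asks for a primitive along `γ` stopped at time `t`; it is shown to be locally constant in
  -- `t`.
  let W : I → Prop := fun t => ∃ Φ, IsContinuation (fun s => γ (min s t)) Φ ∧ Φ 0 =ᶠ[𝓝 (γ 0)] Y
  have hW0 : W 0 := by
    refine ⟨fun _ => Y, IsContinuation.of_analyticAt fun t => ?_, EventuallyEq.rfl⟩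
    rwa [min_eq_right (show (0 : I) ≤ t from t.2.1)]
  have key : ∀ t, ∃ ε > 0, ∀ u ∈ Metric.ball t ε, ∀ v ∈ Metric.ball t ε, W u → W v := by
    intro t
    obtain ⟨r, hr, hrf⟩ := exists_ball_analyticOnNhd (hφ t).1
    obtain ⟨G, hGa, hG⟩ := exists_primitive_on_ball hrf
    obtain ⟨ε, hε, hV⟩ := Metric.eventually_nhds_iff_ball.1
      (((hγ.tendsto t).eventually (Metric.ball_mem_nhds (γ t) hr)).and (hφ t).2)
    refine ⟨ε, hε, fun u hu v hv ⟨Φ, hΦ, hΦ0⟩ => ?_⟩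
    rcases le_or_gt v u with huv | huv
    · refine ⟨Φ ∘ fun s => min s v, ?_, ?_⟩
      · have := hΦ.comp_continuous (τ := fun s => min s v) (by fun_prop)
        convert this using 2 with s
        simp [min_assoc, min_eq_left huv]
      · simpa [min_eq_left (show (0 : I) ≤ v from v.2.1)] using hΦ0
    · have hd : _root_.deriv (Φ u) =ᶠ[𝓝 (γ u)] _root_.deriv G := by
        have h1 := (hΦ.deriv).unique (by fun_prop)
          (hφ.comp_continuous (τ := fun s => min s u) (by fun_prop)) (t₀ := 0) (by
            simpa [min_eq_left (show (0 : I) ≤ u from u.2.1)] using hΦ0.deriv.trans h0) u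
        simp only [min_self, Function.comp_apply] at h1
        refine h1.trans ((hV u hu).2.trans ?_)
        filter_upwards [Metric.isOpen_ball.mem_nhds (hV u hu).1] with z hz using (hG z hz).symm
      have hΦu := (hΦ u).1
      dsimp only at hΦu
      rw [min_self] at hΦu
      -- To extend from `u` to `v`, the primitive `G` on the disc is shifted by the constant that
      -- matches it with `Φ u` at `γ u`.
      obtain ⟨c, hc⟩ := exists_eventuallyEq_add_const hΦu (hGa _ (hV u hu).1) hd
      refine ⟨fun s => if s ≤ u then Φ s else fun w => G w + c,
        IsContinuation.glue (u := u) (by fun_prop) ?_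
          (IsContinuation.of_analyticAt fun s => ?_) ?_, ?_⟩
      · convert hΦ using 2 with s
        simp [min_assoc, min_eq_left huv.le]
      · refine (hGa _ (hV _ ?_).1).add analyticAt_const
        have h2 : u ≤ min (max s u) v := le_min (le_max_right _ _) huv.le
        have h3 : min (max s u) v ≤ v := min_le_right _ _
        have hu' := hu
        have hv' := hv
        rw [Metric.mem_ball, Subtype.dist_eq, Real.dist_eq, abs_lt] at hu' hv' ⊢
        have h2' : (u : ℝ) ≤ ((min (max s u) v : I) : ℝ) := h2
        have h3' : ((min (max s u) v : I) : ℝ) ≤ v := h3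
        constructor <;> linarith [hu'.1, hu'.2, hv'.1, hv'.2]
      · simpa [min_eq_left huv.le] using hc
      · simpa [show (0 : I) ≤ u from u.2.1] using hΦ0
  have hW : W 1 := by
    refine forall_of_eventually_iff (fun t => ?_) hW0 1
    obtain ⟨ε, hε, h⟩ := key t
    filter_upwards [Metric.ball_mem_nhds t hε] with s hs
    exact ⟨h s hs t (Metric.mem_ball_self hε), h t (Metric.mem_ball_self hε) s hs⟩
  obtain ⟨Φ, hΦ, hΦ0⟩ := hW
  refine ⟨Φ, ?_, hΦ0⟩
  convert hΦ using 2 with s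
  rw [min_eq_left (show s ≤ 1 from s.2.2)]

theorem Continues.exists_primitive {a b : ℂ} {γ : Path a b} {f h Y : ℂ → ℂ}
    (H : Continues γ f h) (hY : AnalyticAt ℂ Y a) (hd : _root_.deriv Y =ᶠ[𝓝 a] f) :
    ∃ Z, Continues γ Y Z := by
  obtain ⟨φ, hφ, h0, h1⟩ := H
  obtain ⟨Φ, hΦ, hΦ0⟩ := hφ.exists_primitive γ.continuous (Y := Y) (by rwa [γ.source])
    (by rw [γ.source]; exact hd.trans h0)
  rw [γ.source] at hΦ0
  exact ⟨Φ 1, Φ, hΦ, hΦ0.symm, EventuallyEq.rfl⟩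

/-! ### Paths avoiding a countable set -/

/-- The disc is homeomorphic to the plane, where the complement of a countable set is path connected
because the real dimension exceeds one. -/
theorem joinedIn_ball_diff_countable {A : Set ℂ} (hA : A.Countable) {c : ℂ} {r : ℝ} {x y : ℂ}
    (hx : x ∈ Metric.ball c r) (hy : y ∈ Metric.ball c r) (hxA : x ∉ A) (hyA : y ∉ A) :
    JoinedIn (Metric.ball c r \ A) x y := by
  have hr : 0 < r := dist_nonneg.trans_lt hx
  let e := OpenPartialHomeomorph.univBall (E := ℂ) c r
  have hs : e.source = Set.univ := OpenPartialHomeomorph.univBall_source c r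
  have ht : e.target = Metric.ball c r := OpenPartialHomeomorph.univBall_target c hr
  have hc : (e ⁻¹' A).Countable := by
    refine hA.preimage_of_injOn fun x _ y _ h => ?_
    exact e.injOn (by simp [hs]) (by simp [hs]) h
  have hp := hc.isPathConnected_compl_of_one_lt_rank (by simp)
  have hcont : Continuous e := OpenPartialHomeomorph.continuous_univBall c r
  have himg := hp.image hcont
  have key : ∀ z ∈ Metric.ball c r, z ∉ A → z ∈ e '' (e ⁻¹' A)ᶜ := by
    intro z hz hzA
    refine ⟨e.symm z, ?_, e.right_inv (ht ▸ hz)⟩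
    simpa [e.right_inv (ht ▸ hz)] using hzA
  refine (himg.joinedIn x (key x hx hxA) y (key y hy hyA)).mono ?_
  rintro _ ⟨z, hz, rfl⟩
  exact ⟨ht ▸ e.map_source (by simp [hs]), hz⟩

theorem exists_notMem_of_eventually {A : Set ℂ} (hA : A.Countable) {x : ℂ} {p : ℂ → Prop}
    (h : ∀ᶠ z in 𝓝 x, p z) : ∃ z, p z ∧ z ∉ A := by
  obtain ⟨z, hz, hzA⟩ := mem_closure_iff_nhds.1 ((hA.dense_compl ℝ) x) _ h
  exact ⟨z, hz, hzA⟩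

/-- Finitely many analytic continuations along a path can be performed along a path that avoids a
given countable set. -/
theorem exists_path_avoiding {ι : Type*} [Finite ι] {A : Set ℂ} (hA : A.Countable) {a b : ℂ}
    (ha : a ∉ A) (hb : b ∉ A) {γ : Path a b} {f h : ι → ℂ → ℂ}
    (H : ∀ j, Continues γ (f j) (h j)) :
    ∃ γ' : Path a b, (∀ t, γ' t ∉ A) ∧ ∀ j, Continues γ' (f j) (h j) := by
  choose φ hφ h0 h1 using H
  -- Since `γ t` itself may lie in `A`, the property carried along `γ` concerns the points near `γ
  -- t` that are off `A`.
  let Q : (ι → ℂ → ℂ) → ℂ → Prop := fun g p =>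
    p ∉ A → ∃ γ' : Path a p, (∀ t, γ' t ∉ A) ∧ ∀ j, Continues γ' (f j) (g j)
  have hball : ∀ t, ∃ r > 0, ∀ j, AnalyticOnNhd ℂ (φ j t) (Metric.ball (γ t) r) := by
    intro t
    obtain ⟨r, hr, h⟩ := Metric.eventually_nhds_iff_ball.1
      (eventually_all.2 fun j => (hφ j t).1.eventually_analyticAt)
    exact ⟨r, hr, fun j w hw => h w hw j⟩
  have step : ∀ (g : ι → ℂ → ℂ) (c : ℂ) (r : ℝ) (_ : ∀ j, AnalyticOnNhd ℂ (g j) (Metric.ball c r)),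
      ∀ x ∈ Metric.ball c r, (∀ᶠ p in 𝓝 x, Q g p) → ∀ q ∈ Metric.ball c r, Q g q := by
    intro g c r hg x hx hQ q hq hqA
    obtain ⟨p, ⟨hp, hpb⟩, hpA⟩ := exists_notMem_of_eventually hA
      (hQ.and (Metric.isOpen_ball.mem_nhds hx))
    obtain ⟨γ', hγ', hc⟩ := hp hpA
    have hJ := joinedIn_ball_diff_countable hA hpb hq hpA hqA
    refine ⟨γ'.trans hJ.somePath, fun t => ?_, fun j => (hc j).trans
      (Continues.of_analyticAt fun t => hg j _ (hJ.somePath_mem t).1)⟩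
    have ht : (γ'.trans hJ.somePath) t ∈ Set.range (γ'.trans hJ.somePath) := ⟨t, rfl⟩
    rw [Path.trans_range] at ht
    rcases ht with ⟨s, hs⟩ | ⟨s, hs⟩
    · exact hs ▸ hγ' s
    · exact hs ▸ (hJ.somePath_mem s).2
  let W : I → Prop := fun t => ∀ᶠ p in 𝓝 (γ t), Q (fun j => φ j t) p
  have hW : W 1 := by
    refine forall_of_eventually_iff (W := W) (t₀ := 0) (fun t => ?_) ?_ 1
    · obtain ⟨r, hr, hg⟩ := hball t
      filter_upwards [(γ.continuous.tendsto t).eventually (Metric.ball_mem_nhds (γ t) hr),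
        eventually_all.2 fun j => (hφ j t).2] with s hs1 hs2
      have hQ : ∀ᶠ p in 𝓝 (γ s), (Q (fun j => φ j s) p ↔ Q (fun j => φ j t) p) := by
        filter_upwards [eventually_all.2 fun j => (hs2 j).eventually_nhds] with p hp'
        have hp : ∀ j, φ j s =ᶠ[𝓝 p] φ j t := hp'
        refine forall_congr' fun _ => exists_congr fun γ' => and_congr_right fun _ =>
          forall_congr' fun j => ?_
        exact ⟨fun h => h.congr EventuallyEq.rfl (hp j).symm,
          fun h => h.congr EventuallyEq.rfl (hp j)⟩
      constructor
      · intro hW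
        filter_upwards [Metric.ball_mem_nhds (γ t) hr] with q hq
        exact step _ _ r hg (γ s) hs1 (by filter_upwards [hW, hQ] with p h1 h2 using h2.1 h1) q hq
      · intro hW
        filter_upwards [Metric.isOpen_ball.mem_nhds hs1, hQ] with q hq hq2
        exact hq2.2 (step _ _ r hg (γ t) (Metric.mem_ball_self hr) hW q hq)
    · obtain ⟨r, hr, hg⟩ := hball 0
      have : ∀ᶠ p in 𝓝 (γ 0), p ∈ Metric.ball (γ 0) r := Metric.ball_mem_nhds _ hr
      filter_upwards [this] with q hq hqA
      have ha' : a ∈ Metric.ball (γ 0) r := by rw [γ.source]; exact Metric.mem_ball_self hr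
      have hJ := joinedIn_ball_diff_countable hA ha' hq ha hqA
      exact ⟨hJ.somePath, fun t => (hJ.somePath_mem t).2, fun j => (Continues.of_analyticAt
        fun t => hg j _ (hJ.somePath_mem t).1).congr (h0 j) EventuallyEq.rfl⟩
  have hb' : Q (fun j => φ j 1) b := by
    have := hW.self_of_nhds
    rwa [γ.target] at this
  obtain ⟨γ', h2, h3⟩ := hb' hb
  exact ⟨γ', h2, fun j => (h3 j).congr EventuallyEq.rfl (h1 j)⟩

/-! ### Countability of the set of points where a prescribed value is taken -/

theorem countable_of_eventually_notMem {S : Set ℂ} (hS : ∀ x ∈ S, ∀ᶠ z in 𝓝[≠] x, z ∉ S) :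
    S.Countable := by
  have hd : IsDiscrete S := isDiscrete_iff_nhdsNE.2 fun x hx => by
    rw [← disjoint_iff, disjoint_principal_right]
    exact hS x hx
  have hl : IsLindelof S := HereditarilyLindelofSpace.isLindelof S
  exact hl.countable_of_isDiscrete hd

theorem countable_eq_of_analyticOnNhd_ball {G : ℂ → ℂ} {c : ℂ} {r : ℝ} {b : ℂ}
    (hG : AnalyticOnNhd ℂ G (Metric.ball c r))
    (hne : ∀ z ∈ Metric.ball c r, ¬ G =ᶠ[𝓝 z] fun _ => b) :
    {z ∈ Metric.ball c r | G z = b}.Countable := by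
  refine countable_of_eventually_notMem fun x hx => ?_
  have := (hG x hx.1).eventually_eq_or_eventually_ne (analyticAt_const (v := b))
  rcases this with h | h
  · exact absurd h (hne x hx.1)
  · filter_upwards [h] with z hz hzS using hz hzS.2

open Classical in
/-- A function holomorphic on the disc `ball q r` with the same germ at `q` as `F`, if there is
one. -/
noncomputable def discExtension (q : ℂ) (F : ℂ → ℂ) (r : ℝ) : ℂ → ℂ :=
  if h : ∃ G : ℂ → ℂ, AnalyticOnNhd ℂ G (Metric.ball q r) ∧ G =ᶠ[𝓝 q] F then h.choose else 0

theorem discExtension_spec {q : ℂ} {F G : ℂ → ℂ} {r : ℝ}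
    (hG : AnalyticOnNhd ℂ G (Metric.ball q r)) (h : G =ᶠ[𝓝 q] F) :
    AnalyticOnNhd ℂ (discExtension q F r) (Metric.ball q r) ∧ discExtension q F r =ᶠ[𝓝 q] F := by
  have H : ∃ G : ℂ → ℂ, AnalyticOnNhd ℂ G (Metric.ball q r) ∧ G =ᶠ[𝓝 q] F := ⟨G, hG, h⟩
  rw [discExtension, dif_pos H]
  exact H.choose_spec

/-- The germs at points of `D` reached from a set of germs by at most `n` steps of rational
radius. -/
def discChains (D : Set ℂ) (T : Set (ℂ × (ℂ → ℂ))) : ℕ → Set (ℂ × (ℂ → ℂ))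
  | 0 => T
  | n + 1 => (fun p : (ℂ × (ℂ → ℂ)) × (ℚ × ℂ) => (p.2.2, discExtension p.1.1 p.1.2 p.2.1)) ''
      (discChains D T n ×ˢ (Set.univ ×ˢ D))

theorem countable_discChains {D : Set ℂ} (hD : D.Countable) {T : Set (ℂ × (ℂ → ℂ))}
    (hT : T.Countable) (n : ℕ) : (discChains D T n).Countable := by
  induction n with
  | zero => exact hT
  | succ n ih => exact (ih.prod (Set.countable_univ.prod hD)).image _

/-- The points where some analytic continuation of `f` takes a value in the countable set `B` are at
most countable in number. -/
theorem countable_continuation_mem {U : Set ℂ} {f : ℂ → ℂ} {B : Set ℂ}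
    (hB : B.Countable) (hne : ∀ b ∈ B, ∀ z ∈ U, ¬ f =ᶠ[𝓝 z] fun _ => b) :
    {w | ∃ γ : I → ℂ, ∃ φ : I → ℂ → ℂ, Continuous γ ∧ IsContinuation γ φ ∧ γ 0 ∈ U ∧
      f =ᶠ[𝓝 (γ 0)] φ 0 ∧ ∃ t, γ t = w ∧ φ t w ∈ B}.Countable := by
  -- Poincaré–Volterra: every continuation can be followed by a chain of discs with rational radii
  -- centred in a countable dense set `D`, so countably many disc functions suffice. A nonconstant
  -- one takes each value countably often. The set `T` may also contain meaningless pairs; only its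
  -- countability matters.
  obtain ⟨D, hDc, hDd⟩ := TopologicalSpace.exists_countable_dense ℂ
  set T₀ : Set (ℂ × (ℂ → ℂ)) := (fun q => (q, f)) '' D with hT₀
  set T : Set (ℂ × (ℂ → ℂ)) := ⋃ n, discChains D T₀ n with hT
  have hTc : T.Countable :=
    Set.countable_iUnion fun n => countable_discChains hDc (hDc.image _) n
  have hstep : ∀ q F, (q, F) ∈ T → ∀ (r : ℚ), ∀ q' ∈ D, (q', discExtension q F r) ∈ T := by
    intro q F h r q' hq'
    obtain ⟨n, hn⟩ := Set.mem_iUnion.1 h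
    exact Set.mem_iUnion.2 ⟨n + 1, ⟨((q, F), (r, q')), ⟨hn, trivial, hq'⟩, rfl⟩⟩
  have hcount : (⋃ p ∈ T, ⋃ r : ℚ, ⋃ b ∈ B,
      {z | AnalyticOnNhd ℂ (discExtension p.1 p.2 r) (Metric.ball p.1 r) ∧
        (∀ z ∈ Metric.ball p.1 r, ¬ discExtension p.1 p.2 r =ᶠ[𝓝 z] fun _ => b) ∧
        z ∈ Metric.ball p.1 r ∧ discExtension p.1 p.2 r z = b}).Countable := by
    refine hTc.biUnion fun p _ => Set.countable_iUnion fun r => hB.biUnion fun b _ => ?_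
    by_cases h : AnalyticOnNhd ℂ (discExtension p.1 p.2 r) (Metric.ball p.1 r) ∧
        ∀ z ∈ Metric.ball p.1 r, ¬ discExtension p.1 p.2 r =ᶠ[𝓝 z] fun _ => b
    · refine (countable_eq_of_analyticOnNhd_ball h.1 h.2).mono ?_
      rintro z ⟨-, -, h1, h2⟩
      exact ⟨h1, h2⟩
    · refine Set.countable_empty.mono ?_
      rintro z ⟨h1, h2, -⟩
      exact h ⟨h1, h2⟩
  refine hcount.mono ?_
  rintro w ⟨γ, φ, hγ, hφ, h0U, h0, t₁, rfl, htB⟩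
  -- passing from one point of `D` close to `γ t` to another
  have move : ∀ t, ∃ r > 0, AnalyticOnNhd ℂ (φ t) (Metric.ball (γ t) (2 * r)) ∧
      ∀ p ∈ Metric.ball (γ t) (r / 2), ∀ F, F =ᶠ[𝓝 p] φ t → ∃ ρ : ℚ,
        Metric.ball (γ t) (r / 2) ⊆ Metric.ball p ρ ∧
        AnalyticOnNhd ℂ (discExtension p F ρ) (Metric.ball p ρ) ∧
        ∀ q ∈ Metric.ball p ρ, discExtension p F ρ =ᶠ[𝓝 q] φ t := by
    intro t
    obtain ⟨R, hR, hRa⟩ := exists_ball_analyticOnNhd (hφ t).1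
    refine ⟨R / 2, by positivity, by convert hRa using 2; ring, fun p hp F hF => ?_⟩
    -- With `p` within `R / 4` of `γ t`, a radius between `R / 2` and `3 * R / 4` keeps the disc
    -- about `p` inside `ball (γ t) R` and still covers `ball (γ t) (R / 4)`.
    obtain ⟨ρ, hρ1, hρ2⟩ := exists_rat_btwn (show R / 2 < 3 * R / 4 by linarith)
    have hsub : Metric.ball p ρ ⊆ Metric.ball (γ t) R := by
      refine Metric.ball_subset_ball' ?_
      have := Metric.mem_ball.1 hp
      linarith
    obtain ⟨e1, e2⟩ := discExtension_spec (hRa.mono hsub) hF.symm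
    refine ⟨ρ, Metric.ball_subset_ball' ?_, e1, fun q hq =>
      eventuallyEq_of_mem_ball e1 (hRa.mono hsub) (Metric.mem_ball_self ?_) hq (e2.trans hF)⟩
    · have := Metric.mem_ball'.1 hp
      linarith
    · linarith
  let Q : I → ℂ → Prop := fun t p => p ∈ D → ∃ F, (p, F) ∈ T ∧ F =ᶠ[𝓝 p] φ t
  let W : I → Prop := fun t => ∀ᶠ p in 𝓝 (γ t), Q t p
  have pick : ∀ (t : I) (x : ℂ), (∀ᶠ p in 𝓝 x, Q t p) → ∀ V ∈ 𝓝 x,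
      ∃ p ∈ V, ∃ F, (p, F) ∈ T ∧ F =ᶠ[𝓝 p] φ t := by
    intro t x hx V hV
    obtain ⟨p, ⟨hp, hpV⟩, hpD⟩ := mem_closure_iff_nhds.1 (hDd x) _ (inter_mem hx hV)
    exact ⟨p, hpV, hp hpD⟩
  have hW : ∀ t, W t := by
    refine forall_of_eventually_iff (W := W) (t₀ := 0) (fun t => ?_) ?_
    · obtain ⟨r, hr, -, hm⟩ := move t
      have step : ∀ x ∈ Metric.ball (γ t) (r / 2), (∀ᶠ p in 𝓝 x, Q t p) →
          ∀ q ∈ Metric.ball (γ t) (r / 2), Q t q := by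
        intro x hx hQ q hq hqD
        obtain ⟨p, hp, F, hFT, hF⟩ := pick t x hQ _ (Metric.isOpen_ball.mem_nhds hx)
        obtain ⟨ρ, hs, -, h2⟩ := hm p hp F hF
        exact ⟨_, hstep p F hFT ρ q hqD, h2 q (hs hq)⟩
      filter_upwards [(hγ.tendsto t).eventually (Metric.ball_mem_nhds (γ t) (half_pos hr)),
        (hφ t).2] with s hs1 hs2
      have hQ : ∀ᶠ p in 𝓝 (γ s), (Q s p ↔ Q t p) := by
        filter_upwards [hs2.eventually_nhds] with p hp'
        have hp : φ s =ᶠ[𝓝 p] φ t := hp'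
        refine forall_congr' fun _ => exists_congr fun F => and_congr_right fun _ => ?_
        exact ⟨fun h => h.trans hp, fun h => h.trans hp.symm⟩
      constructor
      · intro hW
        filter_upwards [Metric.ball_mem_nhds (γ t) (half_pos hr)] with q hq
        exact step (γ s) hs1 (by filter_upwards [hW, hQ] with p h1 h2 using h2.1 h1) q hq
      · intro hW
        filter_upwards [Metric.isOpen_ball.mem_nhds hs1, hQ] with q hq hq2
        exact hq2.2 (step (γ t) (Metric.mem_ball_self (half_pos hr)) hW q hq)
    · filter_upwards [h0.eventually_nhds] with p hp hpD
      exact ⟨f, Set.mem_iUnion.2 ⟨0, ⟨p, hpD, rfl⟩⟩, hp⟩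
  obtain ⟨r, hr, -, hm⟩ := move t₁
  obtain ⟨p, hp, F, hFT, hF⟩ := pick t₁ _ (hW t₁) _ (Metric.ball_mem_nhds _ (half_pos hr))
  obtain ⟨ρ, hs, h1, h2⟩ := hm p hp F hF
  have hmem := hs (Metric.mem_ball_self (half_pos hr))
  simp only [Set.mem_iUnion, exists_prop]
  refine ⟨(p, F), hFT, ρ, _, htB, h1, fun z hz hconst => ?_, hmem, (h2 _ hmem).self_of_nhds⟩
  -- If the disc function were constant, continuing back to time `0` would make `f` constant near `γ
  -- 0`, against `hne`.
  have h3 : discExtension p F ρ =ᶠ[𝓝 (γ t₁)] fun _ => φ t₁ (γ t₁) :=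
    eventuallyEq_of_mem_ball h1 (fun _ _ => analyticAt_const) hz hmem hconst
  have h4 := hφ.unique hγ (IsContinuation.of_analyticAt fun _ => analyticAt_const)
    ((h2 _ hmem).symm.trans h3) 0
  exact hne _ htB _ h0U (h0.trans h4)

/-! ### Iterated commutators of loops -/

/-- The loops generated, up to composition and inversion, by the commutators of the loops in `S`. -/
inductive CommClosure {a : ℂ} (S : Path a a → Prop) : Path a a → Prop
  | refl : CommClosure S (Path.refl a)
  | symm {γ : Path a a} (hγ : CommClosure S γ) : CommClosure S γ.symm
  | trans {γ δ : Path a a} (hγ : CommClosure S γ) (hδ : CommClosure S δ) :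
      CommClosure S (γ.trans δ)
  | comm {γ δ : Path a a} (hγ : S γ) (hδ : S δ) :
      CommClosure S ((γ.trans δ).trans (γ.symm.trans δ.symm))

/-- The loops at `a` that avoid `A` and represent elements of the `n`-th derived subgroup. -/
def DLoop (A : Set ℂ) (a : ℂ) : ℕ → Path a a → Prop
  | 0 => fun γ => ∀ t, γ t ∉ A
  | n + 1 => CommClosure (DLoop A a n)

theorem trans_notMem {A : Set ℂ} {a b c : ℂ} {γ : Path a b} {δ : Path b c} (hγ : ∀ t, γ t ∉ A)
    (hδ : ∀ t, δ t ∉ A) (t : I) : (γ.trans δ) t ∉ A := by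
  have ht : (γ.trans δ) t ∈ Set.range (γ.trans δ) := ⟨t, rfl⟩
  rw [Path.trans_range] at ht
  rcases ht with ⟨s, hs⟩ | ⟨s, hs⟩
  · exact hs ▸ hγ s
  · exact hs ▸ hδ s

theorem symm_notMem {A : Set ℂ} {a b : ℂ} {γ : Path a b} (hγ : ∀ t, γ t ∉ A) (t : I) :
    γ.symm t ∉ A := hγ _

theorem CommClosure.mono {a : ℂ} {S S' : Path a a → Prop} (h : ∀ γ, S γ → S' γ) {γ : Path a a}
    (hγ : CommClosure S γ) : CommClosure S' γ := by
  induction hγ with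
  | refl => exact .refl
  | symm _ ih => exact ih.symm
  | trans _ _ ih₁ ih₂ => exact ih₁.trans ih₂
  | comm h₁ h₂ => exact .comm (h _ h₁) (h _ h₂)

namespace DLoop

variable {A A' : Set ℂ} {a : ℂ} {n : ℕ} {γ δ : Path a a}

theorem mono (hA : A ⊆ A') (h : DLoop A' a n γ) : DLoop A a n γ := by
  induction n generalizing γ with
  | zero => exact fun t ht => h t (hA ht)
  | succ n ih => exact CommClosure.mono (fun _ => ih) h

theorem refl (ha : a ∉ A) : DLoop A a n (Path.refl a) := by
  cases n with
  | zero => exact fun _ => ha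
  | succ n => exact CommClosure.refl

theorem symm (h : DLoop A a n γ) : DLoop A a n γ.symm := by
  cases n with
  | zero => exact symm_notMem h
  | succ n => exact CommClosure.symm h

theorem trans (h : DLoop A a n γ) (h' : DLoop A a n δ) : DLoop A a n (γ.trans δ) := by
  cases n with
  | zero => exact trans_notMem h h'
  | succ n => exact CommClosure.trans h h'

theorem of_succ (ha : a ∉ A) (h : DLoop A a (n + 1) γ) : DLoop A a n γ := by
  induction h with
  | refl => exact refl ha
  | symm _ ih => exact ih.symm
  | trans _ _ ih₁ ih₂ => exact ih₁.trans ih₂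
  | comm h₁ h₂ => exact (h₁.trans h₂).trans (h₁.symm.trans h₂.symm)

theorem notMem (ha : a ∉ A) (h : DLoop A a n γ) (t : I) : γ t ∉ A := by
  induction n with
  | zero => exact h t
  | succ n ih => exact ih (of_succ ha h)

end DLoop

/-- If every loop in `S` changes `Z` by one of pairwise commuting entire transformations, then the
commutators of these loops preserve `Z`. -/
theorem CommClosure.continues_self {a : ℂ} {S : Path a a → Prop} {ι : Type*} {T : ι → ℂ → ℂ}
    (hT : ∀ c, Differentiable ℂ (T c)) (hcomm : ∀ c d, T c ∘ T d = T d ∘ T c) {Z : ℂ → ℂ}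
    (hZ : AnalyticAt ℂ Z a) (hS : ∀ γ, S γ → ∃ c, Continues γ Z (T c ∘ Z)) {γ : Path a a}
    (hγ : CommClosure S γ) : Continues γ Z Z := by
  induction hγ with
  | refl => exact Continues.of_analyticAt fun _ => hZ
  | symm _ ih => exact ih.symm
  | trans _ _ ih₁ ih₂ => exact ih₁.trans ih₂
  | comm h₁ h₂ =>
    obtain ⟨c, hc⟩ := hS _ h₁
    obtain ⟨d, hd⟩ := hS _ h₂
    -- Along the commutator the germ runs through `Z`, `T c ∘ Z`, `T d ∘ T c ∘ Z`, `T d ∘ Z` and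
    -- back to `Z`; commutation identifies the middle term.
    have e1 := hd.comp_left (hT c)
    have e2 := (hc.comp_left (hT d)).symm
    rw [← Function.comp_assoc, hcomm c d, Function.comp_assoc] at e1
    exact (hc.trans e1).trans (e2.trans hd.symm)

/-! ### Continuation of quotients and compositions -/

theorem IsContinuation.exists_continues_initial {a b : ℂ} {γ : Path a b} {φ : I → ℂ → ℂ}
    (hφ : IsContinuation γ φ) (t : I) : ∃ δ : Path a (γ t), Set.range δ ⊆ Set.range γ ∧
      Continues δ (φ 0) (φ t) := by
  let τ : I → I := fun s => min s t
  have hτ : Continuous τ := by fun_prop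
  have h0 : τ 0 = 0 := min_eq_left t.2.1
  have h1 : τ 1 = t := min_eq_right t.2.2
  let δ : Path a (γ t) := ⟨⟨γ ∘ τ, γ.continuous.comp hτ⟩, by simp [h0], by simp [h1]⟩
  refine ⟨δ, Set.range_comp_subset_range τ γ, φ ∘ τ, hφ.comp_continuous hτ, ?_, ?_⟩
  · simp [h0]
  · simp [h1]

theorem IsContinuation.value_notMem {a b : ℂ} {γ : Path a b} {φ : I → ℂ → ℂ} {B : Set ℂ}
    (hφ : IsContinuation γ φ) {f : ℂ → ℂ} (h0 : f =ᶠ[𝓝 a] φ 0)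
    (hB : ∀ (w : ℂ) (δ : Path a w), Set.range δ ⊆ Set.range γ → ∀ k, Continues δ f k → k w ∉ B)
    (t : I) : φ t (γ t) ∉ B := by
  obtain ⟨δ, hδ, hc⟩ := hφ.exists_continues_initial t
  exact hB _ δ hδ _ (hc.congr h0 EventuallyEq.rfl)

namespace Continues

variable {a b : ℂ} {γ : Path a b} {f h : ℂ → ℂ}

theorem inv (H : Continues γ f h) (hB : ∀ (w : ℂ) (δ : Path a w), Set.range δ ⊆ Set.range γ →
    ∀ k, Continues δ f k → k w ∉ ({0} : Set ℂ)) : Continues γ f⁻¹ h⁻¹ := by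
  obtain ⟨φ, hφ, h0, h1⟩ := H
  exact ⟨_, hφ.inv (hφ.value_notMem h0 hB), h0.inv, h1.inv⟩

/-- The path `η` is traced by the values of the continuation of `f`; continuations along `η` pull
back to continuations along `γ`. -/
theorem exists_value_path (H : Continues γ f h) {B : Set ℂ}
    (hB : ∀ (w : ℂ) (δ : Path a w), Set.range δ ⊆ Set.range γ → ∀ k, Continues δ f k → k w ∉ B) :
    ∃ η : Path (f a) (h b), (∀ t, η t ∉ B) ∧
      ∀ χ χ', Continues η χ χ' → Continues γ (χ ∘ f) (χ' ∘ h) := by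
  have hfa := H.analyticAt_left
  have hhb := H.analyticAt_right
  obtain ⟨φ, hφ, h0, h1⟩ := H
  let η : Path (f a) (h b) := ⟨⟨fun t => φ t (γ t), hφ.continuous_value γ.continuous⟩, by
    simp [h0.self_of_nhds], by simp [h1.self_of_nhds]⟩
  refine ⟨η, hφ.value_notMem h0 hB, ?_⟩
  rintro χ χ' ⟨Χ, hΧ, e0, e1⟩
  refine ⟨_, hφ.comp hΧ, ?_, ?_⟩
  · filter_upwards [h0, hfa.continuousAt.eventually e0] with z hz1 hz2
    rw [Function.comp_apply, Function.comp_apply, hz2, hz1]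
  · filter_upwards [h1, hhb.continuousAt.eventually e1] with z hz1 hz2
    rw [Function.comp_apply, Function.comp_apply, hz2, hz1]

end Continues

/-! ### Functions with solvable monodromy -/

/-- The function `f`, holomorphic near `z`, can be continued along all paths avoiding `A`, and all
the germs obtained in this way are preserved by the `n`-th derived subgroup of the group of loops
avoiding `A`. -/
def SolvableOff (A : Set ℂ) (n : ℕ) (z : ℂ) (f : ℂ → ℂ) : Prop :=
  ∀ (w : ℂ) (ρ : Path z w), (∀ t, ρ t ∉ A) →
    ∃ h, Continues ρ f h ∧ ∀ γ, DLoop A w n γ → Continues γ h h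

namespace SolvableOff

variable {A A' : Set ℂ} {n : ℕ} {z : ℂ} {f g : ℂ → ℂ}

theorem congr (hf : SolvableOff A n z f) (h : g =ᶠ[𝓝 z] f) : SolvableOff A n z g := by
  intro w ρ hρ
  obtain ⟨k, hk, hk'⟩ := hf w ρ hρ
  exact ⟨k, hk.congr h EventuallyEq.rfl, hk'⟩

theorem mono (hf : SolvableOff A n z f) (hA : A ⊆ A') : SolvableOff A' n z f := by
  intro w ρ hρ
  obtain ⟨k, hk, hk'⟩ := hf w ρ fun t ht => hρ t (hA ht)
  exact ⟨k, hk, fun γ hγ => hk' γ (hγ.mono hA)⟩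

theorem succ (hf : SolvableOff A n z f) : SolvableOff A (n + 1) z f := by
  intro w ρ hρ
  obtain ⟨k, hk, hk'⟩ := hf w ρ hρ
  have hw : w ∉ A := by simpa using hρ 1
  exact ⟨k, hk, fun γ hγ => hk' γ (hγ.of_succ hw)⟩

theorem of_differentiable (hf : Differentiable ℂ f) : SolvableOff A n z f := fun _ _ _ =>
  ⟨f, Continues.of_differentiable hf, fun _ _ => Continues.of_differentiable hf⟩

theorem add (hf : SolvableOff A n z f) (hg : SolvableOff A n z g) : SolvableOff A n z (f + g) := by
  intro w ρ hρ
  obtain ⟨h, hh, hh'⟩ := hf w ρ hρ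
  obtain ⟨k, hk, hk'⟩ := hg w ρ hρ
  exact ⟨_, hh.add hk, fun γ hγ => (hh' γ hγ).add (hk' γ hγ)⟩

theorem mul (hf : SolvableOff A n z f) (hg : SolvableOff A n z g) : SolvableOff A n z (f * g) := by
  intro w ρ hρ
  obtain ⟨h, hh, hh'⟩ := hf w ρ hρ
  obtain ⟨k, hk, hk'⟩ := hg w ρ hρ
  exact ⟨_, hh.mul hk, fun γ hγ => (hh' γ hγ).mul (hk' γ hγ)⟩

theorem comp_left (hf : SolvableOff A n z f) {F : ℂ → ℂ} (hF : Differentiable ℂ F) :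
    SolvableOff A n z (F ∘ f) := by
  intro w ρ hρ
  obtain ⟨h, hh, hh'⟩ := hf w ρ hρ
  exact ⟨_, hh.comp_left hF, fun γ hγ => (hh' γ hγ).comp_left hF⟩

theorem continues_notMem {B : Set ℂ} (hB : ∀ (w : ℂ) (ρ : Path z w) (h : ℂ → ℂ), (∀ t, ρ t ∉ A) →
    Continues ρ f h → h w ∉ B) {w : ℂ} {ρ : Path z w} (hρ : ∀ t, ρ t ∉ A) {h : ℂ → ℂ}
    (hh : Continues ρ f h) {w' : ℂ} {γ : Path w w'} (hγ : ∀ t, γ t ∉ A) (v : ℂ) (δ : Path w v)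
    (hδ : Set.range δ ⊆ Set.range γ) (k : ℂ → ℂ) (hk : Continues δ h k) : k v ∉ B := by
  refine hB v (ρ.trans δ) k (trans_notMem hρ fun t => ?_) (hh.trans hk)
  obtain ⟨s, hs⟩ := hδ ⟨t, rfl⟩
  exact hs ▸ hγ s

theorem inv (hf : SolvableOff A n z f)
    (hB : ∀ (w : ℂ) (ρ : Path z w) (h : ℂ → ℂ), (∀ t, ρ t ∉ A) → Continues ρ f h →
      h w ∉ ({0} : Set ℂ)) : SolvableOff A n z f⁻¹ := by
  intro w ρ hρ
  obtain ⟨h, hh, hh'⟩ := hf w ρ hρ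
  have hw : w ∉ A := by simpa using hρ 1
  refine ⟨_, hh.inv fun v δ hδ k hk => hB v δ k (fun t => ?_) hk,
    fun γ hγ => (hh' γ hγ).inv (continues_notMem hB hρ hh (hγ.notMem hw))⟩
  obtain ⟨s, hs⟩ := hδ ⟨t, rfl⟩
  exact hs ▸ hρ s

/-- A loop in the `n`-th derived subgroup fixes the germ of the derivative, hence adds a constant to
the primitive. Translations commute, so commutators of such loops fix the primitive. -/
theorem primitive (hf : SolvableOff A n z f) (hg : AnalyticAt ℂ g z) (h : deriv g =ᶠ[𝓝 z] f) :
    SolvableOff A (n + 1) z g := by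
  intro w ρ hρ
  obtain ⟨k, hk, hk'⟩ := hf w ρ hρ
  obtain ⟨Z, hZ⟩ := hk.exists_primitive hg h
  have hd : deriv Z =ᶠ[𝓝 w] k := hZ.deriv.unique hk h
  refine ⟨Z, hZ, fun γ hγ => CommClosure.continues_self (T := fun c w => w + c)
    (fun c => by fun_prop) (fun c d => ?_) hZ.analyticAt_right (fun δ hδ => ?_) hγ⟩
  · ext w
    simp only [Function.comp_apply]
    ring
  · obtain ⟨Z', hZ'⟩ := (hk' δ hδ).exists_primitive hZ.analyticAt_right hd
    have hd' : deriv Z' =ᶠ[𝓝 w] deriv Z := (hZ'.deriv.unique (hk' δ hδ) hd).trans hd.symm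
    obtain ⟨c, hc⟩ := exists_eventuallyEq_add_const hZ'.analyticAt_right hZ.analyticAt_right hd'
    exact ⟨c, hZ'.congr EventuallyEq.rfl hc.symm⟩

/-- If `G` is a primitive of `f`, then `g * exp (-G)` has zero derivative, so `g = c * exp G` is an
entire function of a primitive. -/
theorem exponential (hf : SolvableOff A n z f) (hfa : AnalyticAt ℂ f z) (hg : AnalyticAt ℂ g z)
    (h : deriv g =ᶠ[𝓝 z] f * g) : SolvableOff A (n + 1) z g := by
  obtain ⟨r, hr, hrf⟩ := exists_ball_analyticOnNhd hfa
  obtain ⟨G, hGa, hG⟩ := exists_primitive_on_ball hrf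
  have hGz := hGa z (Metric.mem_ball_self hr)
  have hGd : deriv G =ᶠ[𝓝 z] f := by
    filter_upwards [Metric.ball_mem_nhds z hr] with w hw using hG w hw
  have hE : AnalyticAt ℂ (fun w => Complex.exp (-G w)) z := hGz.neg.cexp
  have hconst : deriv (fun w => g w * Complex.exp (-G w)) =ᶠ[𝓝 z] deriv fun _ => (0 : ℂ) := by
    filter_upwards [h, hGd, hg.eventually_analyticAt, hGz.eventually_analyticAt] with w h1 h2 h3 h4
    have e1 := h3.differentiableAt.hasDerivAt
    have e2 := h4.differentiableAt.hasDerivAt.neg.cexp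
    rw [deriv_const]
    refine (e1.mul e2).deriv.trans ?_
    rw [h1, h2, Pi.mul_apply, Pi.neg_apply]
    ring
  obtain ⟨c, hc⟩ := exists_eventuallyEq_add_const (hg.mul hE) analyticAt_const hconst
  refine ((hf.primitive hGz hGd).comp_left (F := fun w => c * Complex.exp w) (by fun_prop)).congr ?_
  filter_upwards [hc] with w hw
  rw [zero_add, Pi.mul_apply] at hw
  rw [Function.comp_apply, ← hw, mul_assoc, ← Complex.exp_add]
  simp

/-- Under a function `h` preserved by the loops in the `n`-th derived subgroup, the loops in the
`(n + m)`-th derived subgroup are mapped to loops in the `m`-th derived subgroup. -/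
theorem exists_dLoop_image {B : Set ℂ} {w : ℂ} {h : ℂ → ℂ} (hh : AnalyticAt ℂ h w)
    (H : ∀ γ, DLoop A w n γ → ∃ η : Path (h w) (h w), (∀ t, η t ∉ B) ∧
      ∀ χ χ', Continues η χ χ' → Continues γ (χ ∘ h) (χ' ∘ h)) (m : ℕ) {γ : Path w w}
    (hγ : DLoop A w (n + m) γ) : ∃ η, DLoop B (h w) m η ∧
      ∀ χ χ', Continues η χ χ' → Continues γ (χ ∘ h) (χ' ∘ h) := by
  induction m generalizing γ with
  | zero => exact H γ hγ
  | succ m ih =>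
    -- The transfer of continuations from `η` to `γ` is stable under reversal and concatenation, so
    -- commutators of the `γ` go with commutators of the `η`.
    have hsymm : ∀ {η : Path (h w) (h w)} {γ : Path w w},
        (∀ χ χ', Continues η χ χ' → Continues γ (χ ∘ h) (χ' ∘ h)) →
        ∀ χ χ', Continues η.symm χ χ' → Continues γ.symm (χ ∘ h) (χ' ∘ h) :=
      fun H χ χ' hc => (H χ' χ (Continues.symm_iff.1 hc)).symm
    have htrans : ∀ {η η' : Path (h w) (h w)} {γ γ' : Path w w},
        (∀ χ χ', Continues η χ χ' → Continues γ (χ ∘ h) (χ' ∘ h)) →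
        (∀ χ χ', Continues η' χ χ' → Continues γ' (χ ∘ h) (χ' ∘ h)) →
        ∀ χ χ', Continues (η.trans η') χ χ' → Continues (γ.trans γ') (χ ∘ h) (χ' ∘ h) := by
      intro η η' γ γ' H H' χ χ' hc
      obtain ⟨k, h1, h2⟩ := hc.of_trans
      exact (H _ _ h1).trans (H' _ _ h2)
    induction hγ with
    | refl =>
      refine ⟨_, CommClosure.refl, fun χ χ' hc => ?_⟩
      obtain ⟨h1, h2⟩ := Continues.refl_iff.1 hc
      exact Continues.refl_iff.2 ⟨h1.comp hh, hh.continuousAt.eventually h2⟩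
    | symm _ ih₁ =>
      obtain ⟨η, hη, hc⟩ := ih₁
      exact ⟨_, hη.symm, hsymm hc⟩
    | trans _ _ ih₁ ih₂ =>
      obtain ⟨η, hη, hc⟩ := ih₁
      obtain ⟨η', hη', hc'⟩ := ih₂
      exact ⟨_, hη.trans hη', htrans hc hc'⟩
    | comm h₁ h₂ =>
      obtain ⟨η, hη, hc⟩ := ih h₁
      obtain ⟨η', hη', hc'⟩ := ih h₂
      exact ⟨_, CommClosure.comm hη hη',
        htrans (htrans hc hc') (htrans (hsymm hc) (hsymm hc'))⟩

/-- Loops in the `n`-th derived subgroup fix the germ of `f`, so their value paths close up to loops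
off `B`. Taking `m` further commutators gives value loops that fix the germ of `g`. -/
theorem comp (hf : SolvableOff A n z f) {B : Set ℂ} {m : ℕ} (hg : SolvableOff B m (f z) g)
    (hB : ∀ (w : ℂ) (ρ : Path z w) (h : ℂ → ℂ), (∀ t, ρ t ∉ A) → Continues ρ f h → h w ∉ B) :
    SolvableOff A (n + m) z (g ∘ f) := by
  intro w ρ hρ
  have hw : w ∉ A := by simpa using hρ 1
  obtain ⟨h, hh, hh'⟩ := hf w ρ hρ
  obtain ⟨η, hη, hc⟩ := hh.exists_value_path (B := B) fun v δ hδ k hk => hB v δ k (fun t => by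
    obtain ⟨s, hs⟩ := hδ ⟨t, rfl⟩
    exact hs ▸ hρ s) hk
  obtain ⟨k, hk, hk'⟩ := hg _ η hη
  refine ⟨_, hc _ _ hk, fun γ hγ => ?_⟩
  obtain ⟨η', hη', hc'⟩ := exists_dLoop_image (B := B) hh.analyticAt_right
    (fun δ hδ => (hh' δ hδ).exists_value_path (continues_notMem hB hρ hh (hδ.notMem hw))) m hγ
  exact hc' _ _ (hk' _ hη')

end SolvableOff

/-! ### Elementary functions have solvable monodromy -/

theorem exists_countable_continues_mem {U : Set ℂ} {f : ℂ → ℂ} {B : Set ℂ} (hB : B.Countable)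
    (hne : ∀ b ∈ B, ∀ z ∈ U, ¬ f =ᶠ[𝓝 z] fun _ => b) :
    ∃ E : Set ℂ, E.Countable ∧ ∀ z ∈ U, ∀ (w : ℂ) (ρ : Path z w) (h : ℂ → ℂ),
      Continues ρ f h → h w ∈ B → w ∈ E := by
  refine ⟨_, countable_continuation_mem hB hne, ?_⟩
  rintro z hz w ρ h ⟨φ, hφ, h0, h1⟩ hw
  refine ⟨ρ, φ, ρ.continuous, hφ, by rwa [ρ.source], by rwa [ρ.source], 1, ρ.target, ?_⟩
  rwa [← h1.self_of_nhds]

/-- All the germs of `f` at points close to `a`, outside a countable set, have a solvable monodromy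
group of derived length at most `n`. -/
def IsTame (n : ℕ) (a : ℂ) (f : ℂ → ℂ) : Prop :=
  ∃ A : Set ℂ, A.Countable ∧ ∀ᶠ z in 𝓝[≠] a, z ∉ A → SolvableOff A n z f

namespace IsTame

variable {n m : ℕ} {a : ℂ} {f g : ℂ → ℂ}

theorem congr (hf : IsTame n a f) (h : g =ᶠ[𝓝[≠] a] f) : IsTame n a g := by
  obtain ⟨A, hA, H⟩ := hf
  refine ⟨A, hA, ?_⟩
  filter_upwards [H, eventually_nhdsNE_eventually_nhds_iff.2 h] with z hz hgz hzA
  exact (hz hzA).congr hgz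

theorem succ (hf : IsTame n a f) : IsTame (n + 1) a f := by
  obtain ⟨A, hA, H⟩ := hf
  exact ⟨A, hA, H.mono fun z hz hzA => (hz hzA).succ⟩

theorem of_differentiable (hf : Differentiable ℂ f) : IsTame n a f :=
  ⟨∅, Set.countable_empty, Eventually.of_forall fun _ _ => SolvableOff.of_differentiable hf⟩

theorem add (hf : IsTame n a f) (hg : IsTame n a g) : IsTame n a (f + g) := by
  obtain ⟨A, hA, H⟩ := hf
  obtain ⟨A', hA', H'⟩ := hg
  refine ⟨A ∪ A', hA.union hA', ?_⟩
  filter_upwards [H, H'] with z h1 h2 hz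
  exact ((h1 fun h => hz (.inl h)).mono Set.subset_union_left).add
    ((h2 fun h => hz (.inr h)).mono Set.subset_union_right)

theorem mul (hf : IsTame n a f) (hg : IsTame n a g) : IsTame n a (f * g) := by
  obtain ⟨A, hA, H⟩ := hf
  obtain ⟨A', hA', H'⟩ := hg
  refine ⟨A ∪ A', hA.union hA', ?_⟩
  filter_upwards [H, H'] with z h1 h2 hz
  exact ((h1 fun h => hz (.inl h)).mono Set.subset_union_left).mul
    ((h2 fun h => hz (.inr h)).mono Set.subset_union_right)

theorem inv (hf : IsTame n a f) (hm : MeromorphicAt f a) : IsTame n a f⁻¹ := by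
  rcases hm.eventually_eq_zero_or_eventually_ne_zero with h0 | h0
  · refine hf.congr ?_
    filter_upwards [h0] with z hz
    simp [hz]
  obtain ⟨A, hA, H⟩ := hf
  obtain ⟨E, hE, hEB⟩ := exists_countable_continues_mem (U := {z | f z ≠ 0}) (f := f)
    (Set.countable_singleton (0 : ℂ)) (by
      rintro b rfl z hz h
      exact hz h.self_of_nhds)
  refine ⟨A ∪ E, hA.union hE, ?_⟩
  filter_upwards [H, h0] with z h1 h2 hz
  refine ((h1 fun h => hz (.inl h)).mono Set.subset_union_left).inv fun w ρ h hρ hc hw => ?_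
  exact hρ 1 (.inr (by simpa using hEB z h2 w ρ h hc hw))

theorem primitive (hf : IsTame n a f) (hg : MeromorphicAt g a) (h : deriv g =ᶠ[𝓝[≠] a] f) :
    IsTame (n + 1) a g := by
  obtain ⟨A, hA, H⟩ := hf
  refine ⟨A, hA, ?_⟩
  filter_upwards [H, hg.eventually_analyticAt, eventually_nhdsNE_eventually_nhds_iff.2 h]
    with z h1 h2 h3 hz
  exact (h1 hz).primitive h2 h3

theorem exponential (hf : IsTame n a f) (hfm : MeromorphicAt f a) (hg : MeromorphicAt g a)
    (h : deriv g =ᶠ[𝓝[≠] a] f * g) : IsTame (n + 1) a g := by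
  obtain ⟨A, hA, H⟩ := hf
  refine ⟨A, hA, ?_⟩
  filter_upwards [H, hfm.eventually_analyticAt, hg.eventually_analyticAt,
    eventually_nhdsNE_eventually_nhds_iff.2 h] with z h1 h2 h3 h4 hz
  exact (h1 hz).exponential h2 h3 h4

theorem comp (hf : IsTame n a f) (hfa : AnalyticAt ℂ f a) (hne : ∀ c, ¬ f =ᶠ[𝓝 a] fun _ => c)
    (hg : IsTame m (f a) g) : IsTame (n + m) a (g ∘ f) := by
  obtain ⟨A, hA, H⟩ := hf
  obtain ⟨B, hB, H'⟩ := hg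
  obtain ⟨E, hE, hEB⟩ := exists_countable_continues_mem
    (U := {z | ∀ c, ¬ f =ᶠ[𝓝 z] fun _ => c}) (f := f) hB fun b _ z hz => hz b
  have hd : ¬ deriv f =ᶠ[𝓝 a] deriv fun _ => (0 : ℂ) := fun h => by
    obtain ⟨c, hc⟩ := exists_eventuallyEq_add_const hfa analyticAt_const h
    exact hne _ hc
  -- Passing to the derivative replaces the varying constant `c` by the single function `0`, so one
  -- neighbourhood serves all `c`.
  have hU : ∀ᶠ z in 𝓝 a, ∀ c, ¬ f =ᶠ[𝓝 z] fun _ => c := by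
    filter_upwards [eventually_eventuallyEq_iff hfa.deriv
      (analyticAt_const (v := (0 : ℂ))).deriv] with z hz c hc
    refine hd (hz.1 (hc.deriv.trans ?_))
    simp
  have hne' : ∀ᶠ z in 𝓝[≠] a, f z ≠ f a :=
    (hfa.eventually_eq_or_eventually_ne analyticAt_const).resolve_left (hne _)
  have ht : Tendsto f (𝓝[≠] a) (𝓝[≠] (f a)) :=
    tendsto_nhdsWithin_iff.2 ⟨hfa.continuousAt.continuousWithinAt, hne'⟩
  refine ⟨A ∪ E, hA.union hE, ?_⟩
  filter_upwards [H, ht.eventually H', hU.filter_mono nhdsWithin_le_nhds,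
    hfa.eventually_analyticAt.filter_mono nhdsWithin_le_nhds] with z h1 h2 h3 h4 hz
  refine ((h1 fun h => hz (.inl h)).mono Set.subset_union_left).comp (h2 fun h => hz (.inr ?_)) ?_
  · exact hEB z h3 z (Path.refl z) f (Continues.of_analyticAt fun _ => h4) h
  · intro w ρ h hρ hc hw
    exact hρ 1 (.inr (by simpa using hEB z h3 w ρ h hc hw))

end IsTame

/-! ### Elementary towers inside the fields of tame germs -/

namespace MeroGerm

/-- The field of germs of meromorphic functions whose monodromy group is solvable of derived length
at most `n`. -/
noncomputable def tame (n : ℕ) (a : ℂ) : Subfield (MeroGerm a) where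
  carrier := {u | ∃ (f : ℂ → ℂ) (hf : MeromorphicAt f a), u = of f hf ∧ IsTame n a f}
  mul_mem' := by
    rintro _ _ ⟨f, hf, rfl, h⟩ ⟨g, hg, rfl, h'⟩
    exact ⟨_, hf.mul hg, rfl, h.mul h'⟩
  one_mem' := ⟨_, MeromorphicAt.const 1 a, rfl, .of_differentiable (by fun_prop)⟩
  add_mem' := by
    rintro _ _ ⟨f, hf, rfl, h⟩ ⟨g, hg, rfl, h'⟩
    exact ⟨_, hf.add hg, rfl, h.add h'⟩
  zero_mem' := ⟨_, MeromorphicAt.const 0 a, rfl, .of_differentiable (by fun_prop)⟩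
  neg_mem' := by
    rintro _ ⟨f, hf, rfl, h⟩
    refine ⟨_, hf.neg, rfl, ?_⟩
    have hc : IsTame n a fun _ => (-1 : ℂ) := .of_differentiable (by fun_prop)
    convert hc.mul h using 1
    ext z
    simp
  inv_mem' := by
    rintro _ ⟨f, hf, rfl, h⟩
    exact ⟨_, hf.inv, rfl, h.inv hf⟩

theorem of_mem_tame {n : ℕ} {a : ℂ} {f : ℂ → ℂ} {hf : MeromorphicAt f a} :
    of f hf ∈ tame n a ↔ IsTame n a f := by
  constructor
  · rintro ⟨g, hg, h, hT⟩
    exact hT.congr (of_eq_of.1 h)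
  · exact fun h => ⟨f, hf, rfl, h⟩

theorem tame_le_succ (n : ℕ) (a : ℂ) : tame n a ≤ tame (n + 1) a := by
  rintro _ ⟨f, hf, rfl, h⟩
  exact of_mem_tame.2 h.succ

theorem ratFunc_le_tame (a : ℂ) : ratFunc a ≤ tame 0 a := by
  refine Subfield.closure_le.2 ?_
  rintro _ (⟨c, rfl⟩ | rfl)
  · exact of_mem_tame.2 (.of_differentiable (by fun_prop))
  · exact of_mem_tame.2 (.of_differentiable (by fun_prop))

/-- Each level is generated over the previous one by a primitive or an exponential, which costs one
derived step; field operations cost none, since the tame germs form a subfield. -/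
theorem tower_le_tame {a : ℂ} {m : ℕ} {K : ℕ → Subfield (MeroGerm a)}
    (hK : IsElementaryTower (ratFunc a) m K) (i : ℕ) (hi : i ≤ m) : K i ≤ tame i a := by
  induction i with
  | zero => exact hK.1 ▸ ratFunc_le_tame a
  | succ i ih =>
    have ih := ih (by omega)
    have hle : (K i : Set (MeroGerm a)) ⊆ tame (i + 1) a := fun u hu => tame_le_succ i a (ih hu)
    rcases hK.2 i (by omega) with ⟨y, ⟨g, hg, hy⟩, hL⟩ | ⟨y, hy, -, hL⟩
    · rw [hL]
      refine Subfield.closure_le.2 (Set.union_subset hle (Set.singleton_subset_iff.2 ?_))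
      obtain ⟨Y, hY, rfl⟩ := exists_of y
      obtain ⟨G, hG, rfl, hT⟩ := ih hg
      rw [deriv_of, of_mul, of_eq_of] at hy
      exact of_mem_tame.2 (hT.exponential hG hY hy)
    · rw [hL]
      refine Subfield.closure_le.2 (Set.union_subset hle (Set.singleton_subset_iff.2 ?_))
      obtain ⟨Y, hY, rfl⟩ := exists_of y
      rw [deriv_of] at hy
      exact of_mem_tame.2 ((of_mem_tame.1 (ih hy)).primitive hY EventuallyEq.rfl)

end MeroGerm

theorem IsElementaryAt.exists_isTame {N : ℕ} {a : ℂ} {f : ℂ → ℂ} (h : IsElementaryAt N a f) :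
    ∃ n, IsTame n a f := by
  obtain ⟨hf, m, -, K, hK, hmem⟩ := h
  exact ⟨m, MeroGerm.of_mem_tame.1 (MeroGerm.tower_le_tame hK m le_rfl hmem)⟩

theorem IsElementaryCompositionAt.analyticAt {N : ℕ} {a : ℂ} {f : ℂ → ℂ}
    (h : IsElementaryCompositionAt N a f) : AnalyticAt ℂ f a := by
  induction h with
  | single h => exact h.1
  | comp h _ ih => exact h.1.comp ih

theorem IsElementaryCompositionAt.exists_isTame {N : ℕ} {a : ℂ} {f : ℂ → ℂ}
    (h : IsElementaryCompositionAt N a f) (hne : ∀ c, ¬ f =ᶠ[𝓝 a] fun _ => c) :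
    ∃ n, IsTame n a f := by
  induction h with
  | single h => exact h.exists_isTame
  | @comp φ g hφ hg ih =>
    -- A nonconstant composite has a nonconstant inner function. This is essential: a constant inner
    -- value could lie in the forbidden set of the outer function.
    have hne' : ∀ c, ¬ g =ᶠ[𝓝 a] fun _ => c := fun c hc => hne (φ c) (hc.fun_comp φ)
    obtain ⟨n, hn⟩ := ih hne'
    obtain ⟨m, hm⟩ := hφ.exists_isTame
    exact ⟨n + m, hn.comp hg.analyticAt hne' hm⟩

/-! ### Branches of the inverse -/

/-- Being joined to `x` off `A`, for all nearby points off `A`, is a locally constant property on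
`X` because discs minus `A` are path connected. -/
theorem joinedIn_diff_countable {X : Set ℂ} (hXo : IsOpen X) (hXc : IsPreconnected X) {A : Set ℂ}
    (hA : A.Countable) {x y : ℂ} (hx : x ∈ X) (hy : y ∈ X) (hxA : x ∉ A) (hyA : y ∉ A) :
    JoinedIn (X \ A) x y := by
  let W : ℂ → Prop := fun p => ∀ᶠ q in 𝓝 p, q ∉ A → JoinedIn (X \ A) x q
  have hball : ∀ p ∈ X, ∃ r > 0, Metric.ball p r ⊆ X := fun p hp => Metric.isOpen_iff.1 hXo p hp
  have step : ∀ (p : ℂ) (r : ℝ), Metric.ball p r ⊆ X → ∀ q ∈ Metric.ball p r, q ∉ A →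
      JoinedIn (X \ A) x q → ∀ q' ∈ Metric.ball p r, q' ∉ A → JoinedIn (X \ A) x q' := by
    intro p r hr q hq hqA hxq q' hq' hqA'
    exact hxq.trans ((joinedIn_ball_diff_countable hA hq hq' hqA hqA').mono
      (Set.sdiff_subset_sdiff_left hr))
  have hloc : ∀ p ∈ X, ∀ᶠ s in 𝓝 p, (W s ↔ W p) := by
    intro p hp
    obtain ⟨r, hr, hrX⟩ := hball p hp
    have key : ∀ s ∈ Metric.ball p r, W s → ∀ s' ∈ Metric.ball p r, W s' := by
      intro s hs hW s' hs'
      obtain ⟨q, ⟨hq, hqb⟩, hqA⟩ := exists_notMem_of_eventually hA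
        (hW.and (Metric.isOpen_ball.mem_nhds hs))
      filter_upwards [Metric.isOpen_ball.mem_nhds hs'] with q' hq' hqA'
      exact step p r hrX q hqb hqA (hq hqA) q' hq' hqA'
    filter_upwards [Metric.ball_mem_nhds p hr] with s hs
    exact ⟨fun h => key s hs h p (Metric.mem_ball_self hr),
      fun h => key p (Metric.mem_ball_self hr) h s hs⟩
  have hxy : W x ↔ W y := by
    refine hXc.induction₂ (fun p q => (W p ↔ W q)) (fun p hp => ?_)
      (fun _ _ _ _ _ _ h h' => h.trans h') (fun _ _ _ _ h => h.symm) hx hy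
    exact ((hloc p hp).mono fun s hs => hs.symm).filter_mono nhdsWithin_le_nhds
  have hWx : W x := by
    obtain ⟨r, hr, hrX⟩ := hball x hx
    filter_upwards [Metric.ball_mem_nhds x hr] with q hq hqA
    exact step x r hrX x (Metric.mem_ball_self hr) hxA (JoinedIn.refl ⟨hx, hxA⟩) q hq hqA
  exact (hxy.1 hWx).self_of_nhds hyA

/-- `ψ` is a holomorphic two-sided local inverse of `f` near `x`. -/
structure IsLocalInverse (f : ℂ → ℂ) (x : ℂ) (ψ : ℂ → ℂ) : Prop where
  analyticAt : AnalyticAt ℂ ψ (f x)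
  apply_eq : ψ (f x) = x
  right_inv : ∀ᶠ z in 𝓝 (f x), f (ψ z) = z
  left_inv : ∀ᶠ w in 𝓝 x, ψ (f w) = w

theorem exists_isLocalInverse {f : ℂ → ℂ} {x : ℂ} (hf : AnalyticAt ℂ f x) (h' : deriv f x ≠ 0) :
    ∃ ψ, IsLocalInverse f x ψ := by
  have hs := hf.hasStrictDerivAt
  have hl := hs.eventually_left_inverse h'
  have hr := hs.eventually_right_inverse h'
  refine ⟨hs.localInverse f _ x h', ?_, hl.self_of_nhds, hr, hl⟩
  exact hf.analyticAt_localInverse h'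

theorem eventuallyEq_of_local_inverse {f ψ χ : ℂ → ℂ} {a x : ℂ} (hψ : ContinuousAt ψ a)
    (hx : ψ a = x) (hr : ∀ᶠ z in 𝓝 a, f (ψ z) = z) (hl : ∀ᶠ w in 𝓝 x, χ (f w) = w) :
    χ =ᶠ[𝓝 a] ψ := by
  subst hx
  filter_upwards [hr, hψ.eventually hl] with z h1 h2
  rw [h1] at h2
  exact h2

/-- As `f (ψ z) = z` stays bounded, `ψ a` is not a pole; the limit of `f` there is `a = f (ψ a)`, so
`f` is continuous and hence analytic at `ψ a`. The chain rule then gives a nonzero derivative. -/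
theorem IsInverseBranchAt.analyticAt_deriv_ne_zero {f ψ : ℂ → ℂ} {X : Set ℂ} {a : ℂ}
    (h : IsInverseBranchAt f X a ψ) (hf : MeromorphicOn f X) :
    AnalyticAt ℂ f (ψ a) ∧ deriv f (ψ a) ≠ 0 := by
  obtain ⟨hψ, hX, hinv⟩ := h
  have hm := hf _ hX
  have hne : ∀ᶠ z in 𝓝[≠] a, ψ z ≠ ψ a := by
    filter_upwards [hinv.filter_mono nhdsWithin_le_nhds, self_mem_nhdsWithin] with z hz hza heq
    rw [heq, hinv.self_of_nhds] at hz
    exact hza hz.symm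
  have ht : Tendsto ψ (𝓝[≠] a) (𝓝[≠] (ψ a)) :=
    tendsto_nhdsWithin_iff.2 ⟨hψ.continuousAt.continuousWithinAt, hne⟩
  have hid : Tendsto (fun z => f (ψ z)) (𝓝[≠] a) (𝓝 a) := by
    refine (tendsto_id.mono_left nhdsWithin_le_nhds).congr' ?_
    filter_upwards [hinv.filter_mono nhdsWithin_le_nhds] with z hz using hz.symm
  have hord : 0 ≤ meromorphicOrderAt f (ψ a) := by
    by_contra hlt
    have := (tendsto_cobounded_of_meromorphicOrderAt_neg (not_le.1 hlt)).comp ht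
    exact this.not_tendsto (Metric.disjoint_nhds_cobounded a).symm hid
  obtain ⟨c, hc⟩ := tendsto_nhds_of_meromorphicOrderAt_nonneg hm hord
  have hca : c = a := tendsto_nhds_unique (hc.comp ht) hid
  have hcont : ContinuousAt f (ψ a) := by
    rw [← continuousWithinAt_compl_self, ContinuousWithinAt, hinv.self_of_nhds]
    exact hca ▸ hc
  have hfa := hm.analyticAt hcont
  refine ⟨hfa, fun h0 => ?_⟩
  have h1 : HasDerivAt (fun z => f (ψ z)) (deriv f (ψ a) * deriv ψ a) a :=
    hfa.differentiableAt.hasDerivAt.comp a hψ.differentiableAt.hasDerivAt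
  have h2 : HasDerivAt (fun z => f (ψ z)) 1 a := (hasDerivAt_id a).congr_of_eventuallyEq hinv
  have := h1.unique h2
  rw [h0, zero_mul] at this
  exact zero_ne_one this

/-- One regular point prevents `deriv f` from vanishing identically on the connected set `X`, so the
exceptional points are isolated. -/
theorem countable_not_regular {f : ℂ → ℂ} {X : Set ℂ} (hXc : IsConnected X)
    (hf : MeromorphicOn f X) {x : ℂ} (hx : x ∈ X) (hfx : AnalyticAt ℂ f x) (h' : deriv f x ≠ 0) :
    {p ∈ X | ¬ (AnalyticAt ℂ f p ∧ deriv f p ≠ 0)}.Countable := by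
  have hx' : meromorphicOrderAt (deriv f) x ≠ ⊤ := by
    rw [(hfx.deriv.meromorphicOrderAt_eq), (hfx.deriv.analyticOrderAt_eq_zero).2 h']
    simp
  have hall := (hf.deriv.exists_meromorphicOrderAt_ne_top_iff_forall hXc).1 ⟨⟨x, hx⟩, hx'⟩
  refine countable_of_eventually_notMem fun p hp => ?_
  have h1 := (meromorphicOrderAt_ne_top_iff_eventually_ne_zero (hf.deriv p hp.1)).1 (hall ⟨p, hp.1⟩)
  filter_upwards [h1, (hf p hp.1).eventually_analyticAt] with z hz1 hz2 hz
  exact hz.2 ⟨hz2, hz1⟩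

/-- Local inverses of `f` along a curve of regular points are analytic continuations of one
another. -/
theorem isContinuation_local_inverse {f : ℂ → ℂ} {η : I → ℂ} (hη : Continuous η) {ψ : I → ℂ → ℂ}
    (hf : ∀ t, ContinuousAt f (η t)) (hψ : ∀ t, IsLocalInverse f (η t) (ψ t)) :
    IsContinuation (fun t => f (η t)) ψ := by
  refine fun t => ⟨(hψ t).analyticAt, ?_⟩
  have hfη : Tendsto (fun s => f (η s)) (𝓝 t) (𝓝 (f (η t))) := (hf t).tendsto.comp (hη.tendsto t)
  filter_upwards [hfη.eventually (hψ t).analyticAt.eventually_analyticAt,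
    hfη.eventually (hψ t).right_inv.eventually_nhds,
    (hη.tendsto t).eventually (hψ t).left_inv] with s h1 h2 h3
  exact eventuallyEq_of_local_inverse h1.continuousAt h3 h2 (hψ s).left_inv

/-- All branches of the inverse are analytic continuations of one another. -/
theorem IsInverseBranchAt.exists_continues {f : ℂ → ℂ} {X : Set ℂ} (hXo : IsOpen X)
    (hXc : IsConnected X) (hf : MeromorphicOn f X) {a b : ℂ} {ψ χ : ℂ → ℂ}
    (hψ : IsInverseBranchAt f X a ψ) (hχ : IsInverseBranchAt f X b χ) :
    ∃ γ : Path a b, Continues γ ψ χ := by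
  have h1 := hψ.analyticAt_deriv_ne_zero hf
  have h2 := hχ.analyticAt_deriv_ne_zero hf
  obtain ⟨hψa, hψX, hψi⟩ := hψ
  obtain ⟨hχa, hχX, hχi⟩ := hχ
  -- Join `ψ a` to `χ b` inside `X` through regular points of `f`; along the image of this path
  -- under `f` the local inverses continue one another.
  have hC := countable_not_regular hXc hf hψX h1.1 h1.2
  have hJ := joinedIn_diff_countable hXo hXc.isPreconnected hC hψX hχX (fun h => h.2 h1)
    (fun h => h.2 h2)
  set η := hJ.somePath
  have hreg : ∀ t, AnalyticAt ℂ f (η t) ∧ deriv f (η t) ≠ 0 := fun t =>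
    not_not.1 fun h => (hJ.somePath_mem t).2 ⟨(hJ.somePath_mem t).1, h⟩
  choose Ψ hΨ using fun t => exists_isLocalInverse (hreg t).1 (hreg t).2
  have hcont := isContinuation_local_inverse η.continuous (fun t => (hreg t).1.continuousAt) hΨ
  have hc : Continuous fun t => f (η t) := continuous_iff_continuousAt.2 fun t =>
    (hreg t).1.continuousAt.comp η.continuous.continuousAt
  refine ⟨⟨⟨fun t => f (η t), hc⟩, by simpa using hψi.self_of_nhds,
    by simpa using hχi.self_of_nhds⟩, Ψ, hcont, ?_, ?_⟩
  · refine (eventuallyEq_of_local_inverse hψa.continuousAt rfl hψi ?_).symm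
    have := (hΨ 0).left_inv
    rwa [η.source] at this
  · refine (eventuallyEq_of_local_inverse hχa.continuousAt rfl hχi ?_).symm
    have := (hΨ 1).left_inv
    rwa [η.target] at this

theorem IsInverseBranchAt.not_eventually_const {f ψ : ℂ → ℂ} {X : Set ℂ} {a : ℂ}
    (h : IsInverseBranchAt f X a ψ) (c : ℂ) : ¬ ψ =ᶠ[𝓝 a] fun _ => c := by
  intro hc
  have : ∀ᶠ z in 𝓝[≠] a, z = f c := by
    filter_upwards [(h.2.2.and hc).filter_mono nhdsWithin_le_nhds] with z hz
    rw [← hz.1, hz.2]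
  have h1 : a = f c := by
    have h0 : ψ a = c := hc.self_of_nhds
    rw [← h0]
    exact h.2.2.self_of_nhds.symm
  obtain ⟨z, hz, hza⟩ := (this.and self_mem_nhdsWithin).exists
  exact hza (hz.trans h1.symm)

theorem exists_continues_of_mem_inverseFun {f : ℂ → ℂ} {X : Set ℂ} (hXo : IsOpen X)
    (hXc : IsConnected X) (hf : MeromorphicOn f X) {a b : ℂ} {ψ h : ℂ → ℂ}
    (hψ : IsInverseBranchAt f X a ψ) {g : HolGerm b} (hg : g ∈ inverseFun f X b)
    (hgh : g.1 = (h : Germ (𝓝 b) ℂ)) : ∃ γ : Path a b, Continues γ ψ h := by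
  obtain ⟨c, χ, hχ, γ, hγ⟩ := hg
  obtain ⟨δ, hδ⟩ := hψ.exists_continues hXo hXc hf hχ
  exact ⟨_, hδ.trans ((continuesTo_iff rfl hgh).1 hγ)⟩

/-! ### Solvability of the monodromy group -/

theorem eventually_exists_path_continues_self {ι : Type*} [Finite ι] {a : ℂ} {f : ι → ℂ → ℂ}
    (hf : ∀ j, AnalyticAt ℂ (f j) a) :
    ∀ᶠ z in 𝓝 a, ∃ γ : Path z a, ∀ j, Continues γ (f j) (f j) := by
  obtain ⟨r, hr, h⟩ := Metric.eventually_nhds_iff_ball.1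
    (eventually_all.2 fun j => (hf j).eventually_analyticAt)
  filter_upwards [Metric.ball_mem_nhds a hr] with z hz
  have hJ := joinedIn_ball_diff_countable Set.countable_empty hz (Metric.mem_ball_self hr)
    (Set.notMem_empty _) (Set.notMem_empty _)
  exact ⟨hJ.somePath, fun j => Continues.of_analyticAt fun t => h _ (hJ.somePath_mem t).1 j⟩

/-- Finitely many analytic continuations along a loop in the `n`-th derived subgroup can also be
performed along a loop in the `n`-th derived subgroup that avoids another countable set. -/
theorem DLoop.eventually_exists {ι : Type*} [Finite ι] {A A' : Set ℂ} (hA' : A'.Countable) {a : ℂ}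
    (n : ℕ) {γ : Path a a} (hγ : DLoop A a n γ) {f h : ι → ℂ → ℂ}
    (H : ∀ j, Continues γ (f j) (h j)) :
    ∀ᶠ z in 𝓝 a, z ∉ A' → ∃ γ', DLoop A' z n γ' ∧ ∀ j, Continues γ' (f j) (h j) := by
  induction n generalizing ι γ f h with
  | zero =>
    filter_upwards [eventually_exists_path_continues_self fun j => (H j).analyticAt_left,
      eventually_exists_path_continues_self fun j => (H j).analyticAt_right]
      with z ⟨σ₁, h₁⟩ ⟨σ₂, h₂⟩ hz
    exact exists_path_avoiding hA' hz hz fun j => ((h₁ j).trans (H j)).trans (h₂ j).symm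
  | succ n ih =>
    induction hγ generalizing ι f h with
    | refl =>
      have := fun j => Continues.refl_iff.1 (H j)
      filter_upwards [eventually_all.2 fun j => (this j).2.eventually_nhds,
        eventually_all.2 fun j => (this j).1.eventually_analyticAt] with z h1 h2 _
      exact ⟨_, CommClosure.refl, fun j => Continues.refl_iff.2 ⟨h2 j, h1 j⟩⟩
    | symm _ ih₁ =>
      filter_upwards [ih₁ fun j => Continues.symm_iff.1 (H j)] with z h1 hz
      obtain ⟨γ', h2, h3⟩ := h1 hz
      exact ⟨_, h2.symm, fun j => (h3 j).symm⟩
    | trans _ _ ih₁ ih₂ =>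
      choose k h1 h2 using fun j => (H j).of_trans
      filter_upwards [ih₁ h1, ih₂ h2] with z e1 e2 hz
      obtain ⟨γ₁, d₁, c₁⟩ := e1 hz
      obtain ⟨γ₂, d₂, c₂⟩ := e2 hz
      exact ⟨_, d₁.trans d₂, fun j => (c₁ j).trans (c₂ j)⟩
    | @comm γ δ hγ hδ =>
      choose k h1 h2 using fun j => (H j).of_trans
      choose k₁ h3 h4 using fun j => (h1 j).of_trans
      choose k₂ h5 h6 using fun j => (h2 j).of_trans
      -- In a commutator each loop is run once in each direction: `γ` carries `f` to `k₁` and `k₂`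
      -- to `k`, while `δ` carries `k₁` to `k` and `h` to `k₂`. A single replacement loop must do
      -- both, which is why the induction runs over finite families.
      filter_upwards [ih hγ (f := Sum.elim f k₂) (h := Sum.elim k₁ k)
          (Sum.rec h3 fun j => Continues.symm_iff.1 (h5 j)),
        ih hδ (f := Sum.elim k₁ h) (h := Sum.elim k k₂)
          (Sum.rec h4 fun j => Continues.symm_iff.1 (h6 j))] with z e1 e2 hz
      obtain ⟨γ₁, d₁, c₁⟩ := e1 hz
      obtain ⟨γ₂, d₂, c₂⟩ := e2 hz
      exact ⟨_, CommClosure.comm d₁ d₂, fun j => ((c₁ (.inl j)).trans (c₂ (.inl j))).trans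
        ((c₁ (.inr j)).symm.trans (c₂ (.inr j)).symm)⟩

theorem exists_dLoop_of_mem_derivedSeries {F : MultiFun} {A : Set ℂ} {a : ℂ} {ha : a ∉ A} (n : ℕ)
    {p : monodromyGroup F A a ha} (hp : p ∈ derivedSeries (monodromyGroup F A a ha) n) :
    ∃ γ, DLoop A a n γ ∧ ∀ g : F a, ContinuesTo γ g.1 (p.1 g).1 := by
  induction n generalizing p with
  | zero => exact p.2
  | succ n ih =>
    rw [derivedSeries_succ, Subgroup.commutator_def] at hp
    induction hp using Subgroup.closure_induction with
    | mem p hp =>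
      obtain ⟨p₁, h₁, p₂, h₂, rfl⟩ := hp
      -- Permutations compose from right to left, so the commutator first applies the inverse of
      -- `p₂`, then that of `p₁`; the loops are chosen to induce these inverses.
      obtain ⟨γ₁, d₁, c₁⟩ := ih (inv_mem h₁)
      obtain ⟨γ₂, d₂, c₂⟩ := ih (inv_mem h₂)
      refine ⟨_, CommClosure.comm d₂ d₁, fun g => ?_⟩
      have e₁ : ∀ g, ContinuesTo γ₁.symm g.1 (p₁.1 g).1 := fun g => by
        simpa using (c₁ (p₁.1 g)).symm
      have e₂ : ∀ g, ContinuesTo γ₂.symm g.1 (p₂.1 g).1 := fun g => by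
        simpa using (c₂ (p₂.1 g)).symm
      exact ((c₂ g).trans (c₁ _)).trans ((e₂ _).trans (e₁ _))
    | one => exact ⟨_, CommClosure.refl, fun g => ContinuesTo.refl g.1⟩
    | mul p q _ _ hp hq =>
      obtain ⟨γ, d, c⟩ := hp
      obtain ⟨γ', d', c'⟩ := hq
      exact ⟨_, d'.trans d, fun g => (c' g).trans (c (q.1 g))⟩
    | inv p _ hp =>
      obtain ⟨γ, d, c⟩ := hp
      exact ⟨_, d.symm, fun g => by simpa using (c (p.1⁻¹ g)).symm⟩

/-- The germs of `F` at all points are obtained from the germ of `ψ` at `a` by continuation. -/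
def IsGeneratedBy (F : MultiFun) (a : ℂ) (ψ : ℂ → ℂ) : Prop :=
  ∀ (b : ℂ) (g : HolGerm b) (h : ℂ → ℂ), g ∈ F b → g.1 = (h : Germ (𝓝 b) ℂ) →
    ∃ γ : Path a b, Continues γ ψ h

/-- Continuation along `γ`, given that along the part of `γ` after the moment `u`. -/
theorem Continues.exists_of_final {b c : ℂ} {γ : Path b c} {f h : ℂ → ℂ} {u : I}
    (hf : ∀ s ≤ u, AnalyticAt ℂ f (γ s)) {δ : Path (γ u) c} (hδ : ∀ s, δ s = γ (max s u))
    (H : Continues δ f h) : Continues γ f h := by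
  obtain ⟨φ, hφ, h0, h1⟩ := H
  have hδ' : (δ : I → ℂ) = fun s => γ (max s u) := funext hδ
  have hu : f =ᶠ[𝓝 (γ u)] φ u := by
    have h2 := (IsContinuation.of_analyticAt (γ := fun s => δ (min s u)) (F := f) fun t => by
      rw [hδ, max_eq_right (min_le_right _ _)]; exact hf u le_rfl).unique (by fun_prop)
      (hφ.comp_continuous (τ := fun s => min s u) (by fun_prop)) (t₀ := 0) (by
        simpa [min_eq_left (show (0 : I) ≤ u from u.2.1)] using h0) u
    simpa [hδ] using h2
  rw [hδ'] at hφ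
  refine ⟨_, IsContinuation.glue γ.continuous (φ := fun _ => f)
    (IsContinuation.of_analyticAt fun s => hf _ (min_le_right _ _)) hφ hu, ?_, ?_⟩
  · simp only [show (0 : I) ≤ u from u.2.1, if_true]
    exact EventuallyEq.rfl
  · rcases eq_or_ne u 1 with rfl | hne
    · have e : γ 1 = c := γ.target
      rw [e] at hu
      simpa using h1.trans hu.symm
    · rw [if_neg (not_le.2 (lt_of_le_of_ne (show u ≤ 1 from u.2.2) hne))]
      exact h1

/-! ### Multivalued functions generated by one germ of solvable monodromy -/

section Generated

variable {F : MultiFun} {n : ℕ} {z₀ : ℂ} {ψ : ℂ → ℂ} {A : Set ℂ}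

theorem IsGeneratedBy.of_continues (hF : IsGeneratedBy F z₀ ψ) {z : ℂ} {γ : Path z z₀}
    (h : Continues γ ψ ψ) : IsGeneratedBy F z ψ := by
  intro b g k hg hk
  obtain ⟨δ, hδ⟩ := hF b g k hg hk
  exact ⟨_, h.trans hδ⟩

theorem isForbiddenSet_of_solvableOff (hF : IsGeneratedBy F z₀ ψ) (hA : A.Countable) (hz : z₀ ∉ A)
    (hS : SolvableOff A n z₀ ψ) : IsForbiddenSet A F := by
  refine ⟨hA, fun b g hg c γ hγ => ?_⟩
  obtain ⟨f, hfa, hgf⟩ := g.2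
  obtain ⟨ρ, hρ⟩ := hF b g f hg hgf
  obtain ⟨r, hr, hrf⟩ := exists_ball_analyticOnNhd hfa
  -- The starting point may lie in `A`. The germ is holomorphic on a disc, so it continues freely up
  -- to some `γ u` with `u > 0`, which is off `A` and can be reached from `z₀` off `A`.
  obtain ⟨u, hu, hγu⟩ : ∃ u : I, 0 < u ∧ ∀ s ≤ u, γ s ∈ Metric.ball b r := by
    have h0 : Tendsto γ (𝓝 0) (𝓝 b) := by simpa using γ.continuous.tendsto 0
    obtain ⟨ε, hε, h⟩ := Metric.eventually_nhds_iff_ball.1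
      (h0.eventually (Metric.ball_mem_nhds b hr))
    have hm : 0 < min (ε / 2) 1 := lt_min (half_pos hε) one_pos
    refine ⟨⟨min (ε / 2) 1, hm.le, min_le_right _ _⟩, hm, fun s hs => h s ?_⟩
    have hs' : (s : ℝ) ≤ min (ε / 2) 1 := hs
    rw [Metric.mem_ball, Subtype.dist_eq, Real.dist_eq, Set.Icc.coe_zero, sub_zero,
      abs_of_nonneg s.2.1]
    linarith [min_le_left (ε / 2) 1]
  have huA : γ u ∉ A := hγ u hu.ne'
  have hJ := joinedIn_ball_diff_countable Set.countable_empty (Metric.mem_ball_self hr)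
    (hγu u le_rfl) (Set.notMem_empty _) (Set.notMem_empty _)
  have hσ : Continues hJ.somePath f f :=
    Continues.of_analyticAt fun t => hrf _ (hJ.somePath_mem t).1
  obtain ⟨ρ', hρ'A, hρ'⟩ := exists_path_avoiding (ι := Unit) hA hz huA fun _ => hρ.trans hσ
  let δ : Path (γ u) c := ⟨⟨fun s => γ (max s u), by fun_prop⟩,
    by simp,
    by simp [max_eq_left (show u ≤ (1 : I) from u.2.2)]⟩
  have hδA : ∀ t, δ t ∉ A := fun t => hγ _ (hu.trans_le (le_max_right _ _)).ne'
  obtain ⟨h, hh, -⟩ := hS c (ρ'.trans δ) (trans_notMem hρ'A hδA)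
  obtain ⟨k, hk, hkh⟩ := hh.of_trans
  have hfk : f =ᶠ[𝓝 (γ u)] k := (hρ' ()).unique hk EventuallyEq.rfl
  have hc : Continues γ f h := Continues.exists_of_final (fun s hs => hrf _ (hγu s hs))
    (δ := δ) (fun _ => rfl) (hkh.congr hfk EventuallyEq.rfl)
  exact ⟨⟨(h : Germ (𝓝 c) ℂ), h, hc.analyticAt_right, rfl⟩, (continuesTo_iff hgf rfl).2 hc⟩

theorem isSolvable_monodromyGroup_of_solvableOff (hF : IsGeneratedBy F z₀ ψ) (hA : A.Countable)
    (hz : z₀ ∉ A) (hS : SolvableOff A n z₀ ψ) (A' : Set ℂ) (a : ℂ) (ha : a ∉ A') :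
    Group.IsSolvable (monodromyGroup F A' a ha) := by
  refine ⟨n, (Subgroup.eq_bot_iff_forall _).2 fun p hp => ?_⟩
  obtain ⟨γ, hγ, hc⟩ := exists_dLoop_of_mem_derivedSeries n hp
  refine Subtype.ext (Equiv.ext fun g => Subtype.ext (Subtype.ext ?_))
  obtain ⟨f, hfa, hf⟩ := g.1.2
  obtain ⟨h, hha, hh⟩ := (p.1 g).1.2
  have hfh : Continues γ f h := (continuesTo_iff hf hh).1 (hc g)
  obtain ⟨ρ, hρ⟩ := hF a g.1 f g.2 hf
  -- The base point `a` may lie in `A`: the loop is moved to a nearby `z` off `A`, so close that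
  -- equality of `f` and `h` at `z` gives equality at `a`.
  obtain ⟨z, ⟨⟨h1, h2⟩, δ, h3⟩, hzA⟩ := exists_notMem_of_eventually hA
    (((DLoop.eventually_exists (ι := Unit) hA n hγ fun _ => hfh).and
      (eventually_eventuallyEq_iff hfa hha)).and
      (eventually_exists_path_continues_self (ι := Unit) fun _ => hfa))
  obtain ⟨γ', hγ', hc'⟩ := h1 hzA
  obtain ⟨ρ', hρ'A, hρ'⟩ := exists_path_avoiding (ι := Unit) hA hz hzA
    fun _ => hρ.trans (h3 ()).symm
  obtain ⟨k, hk, hkγ⟩ := hS z ρ' hρ'A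
  have hkf : k =ᶠ[𝓝 z] f := hk.unique (hρ' ()) EventuallyEq.rfl
  have hkh : k =ᶠ[𝓝 z] h := (hkγ γ' hγ').unique (hc' ()) hkf
  have : f =ᶠ[𝓝 a] h := h2.1 (hkf.symm.trans hkh)
  exact hh.trans ((Germ.coe_eq.2 this).symm.trans hf.symm)

end Generated

end TopGalois

/-! ### The main theorem -/

theorem mainTheorem4 (N : ℕ) (hN : 0 < N) (X : Set ℂ) (hXo : IsOpen X) (hXc : IsConnected X)
    (f : ℂ → ℂ) (hf : MeromorphicOn f X)
    (hinv : TopGalois.InverseIsElementaryComposition f X N) :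
    (∃ A : Set ℂ, TopGalois.IsForbiddenSet A (TopGalois.inverseFun f X)) ∧
    ∀ A : Set ℂ, TopGalois.IsForbiddenSet A (TopGalois.inverseFun f X) →
      ∀ (a : ℂ) (ha : a ∉ A),
        Group.IsSolvable (TopGalois.monodromyGroup (TopGalois.inverseFun f X) A a ha) := by
  obtain ⟨z₀, ψ, hψ, hcomp⟩ := hinv
  obtain ⟨n, A, hA, hS⟩ := hcomp.exists_isTame hψ.not_eventually_const
  have hF : TopGalois.IsGeneratedBy (TopGalois.inverseFun f X) z₀ ψ := fun b g h hg hgh =>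
    TopGalois.exists_continues_of_mem_inverseFun hXo hXc hf hψ hg hgh
  have hev := (eventually_nhdsWithin_iff.1 hS).and
    (TopGalois.eventually_exists_path_continues_self (ι := Unit) fun _ => hψ.1)
  -- Tameness speaks only of a punctured neighbourhood of `z₀`, so `z₀` is avoided together with
  -- `A`.
  obtain ⟨z, ⟨hSz, γ, hγ⟩, hz⟩ :=
    TopGalois.exists_notMem_of_eventually (hA.union (Set.countable_singleton z₀)) hev
  have hzA : z ∉ A := fun h => hz (.inl h)
  have hSz' := hSz (fun h => hz (.inr h)) hzA
  have hFz := hF.of_continues (hγ ())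
  exact ⟨⟨A, TopGalois.isForbiddenSet_of_solvableOff hFz hA hzA hSz'⟩, fun A' _ a ha =>
    TopGalois.isSolvable_monodromyGroup_of_solvableOff hFz hA hzA hSz' A' a ha⟩
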